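/- All manifolds are smooth, Hausdorff and finite-dimensional, and all vector bundles are smooth, real and of finite rank. **Definitions.** A *skew-symmetric algebroid* structure on a vector bundle $\tau_E:E\to Q$ consists of a skew-symmetric $\mathbb R$-bilinear bracket $[\![\cdot,\cdot]\!]$ on $\Gamma(E)$ and an anchor, i.e. a vector bundle morphism $\rho:E\to TQ$ over the identity, such that $[\![\sigma,f\gamma]\!]=f[\![\sigma,\gamma]\!]+\rho(\sigma)(f)\,\gamma$ for $\sigma,\gamma\in\Gamma(E)$, $f\in C^\infty(Q)$. It induces the *linear almost Poisson bracket* $\{\cdot,\cdot\}_{E^*}$ on $C^\infty(E^*)$: the unique skew-symmetric $\mathbb R$-bilinear bracket which is a derivation in each argument and satisfies $$\{\widehat\sigma,\widehat\gamma\}=-\widehat{[\![\sigma,\gamma]\!]},\qquad \{f\circ\tau_{E^*},\widehat\sigma\}=\rho(\sigma)(f)\circ\tau_{E^*},\qquad \{f\circ\tau_{E^*},g\circ\tau_{E^*}\}=0,$$ where $\widehat\sigma:E^*\to\mathbb R$ is the fibrewise linear function defined by $\sigma\in\Gamma(E)$. A section $\phi\in\Gamma(E^*)$ is a *$1$-cocycle*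 if $\rho(\sigma)(\phi(\gamma))-\rho(\gamma)(\phi(\sigma))-\phi([\![\sigma,\gamma]\!])=0$ for all $\sigma,\gamma\in\Gamma(E)$. Let $\phi$ be a $1$-cocycle with $\phi(q)\neq0$ for all $q\in Q$. Then $V=\{e\in E:\phi(e)=0\}$ is a vector subbundle of $E$, which inherits a skew-symmetric algebroid structure by restriction of the bracket and of the anchor, and hence a bracket $\{\cdot,\cdot\}_{V^*}$ on $C^\infty(V^*)$. Let $i_V:V\to E$ be the inclusion and $\mu=i_V^*:E^*\to V^*$. A *Hamiltonian system* $(E,[\![\cdot,\cdot]\!],\rho,\phi,h)$ consists of a skew-symmetric algebroid, such a $\phi$, and a smooth section $h:V^*\to E^*$ of $\mu$ (so $\mu\circ h=\mathrm{id}$; $h$ need not be linear). It defines * the function $F_h\in C^\infty(E^*)$ with $\alpha_q-h(\mu(\alpha_q))=F_h(\alpha_q)\,\phi(q)$ for $\alpha_q\in E^*_q$; * the *Hamiltonian vector field* $R_h$ on $V^*$, characterized by $R_h(G)\circ\mu=\{G\circ\mu,F_h\}_{E^*}$ for all $G\in C^\infty(V^*)$; * for $\alpha\in\Gamma(V^*)$,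 the vector field $R_h^\alpha=T\tau_{V^*}\circ R_h\circ\alpha$ on $Q$, where $\tau_{V^*}:V^*\to Q$ is the projection. Let $(E,\ldots,\phi,h)$ over $Q$ and $(\bar E,\ldots,\bar\phi,\bar h)$ over $\bar Q$ be Hamiltonian systems. A *Hamiltonian morphism* is a vector bundle morphism $\Psi:E^*\to\bar E^*$ over a smooth map $\psi:Q\to\bar Q$ such that $\{\bar F_1\circ\Psi,\bar F_2\circ\Psi\}_{E^*}=\{\bar F_1,\bar F_2\}_{\bar E^*}\circ\Psi$ for all $\bar F_1,\bar F_2\in C^\infty(\bar E^*)$, $\Psi\circ\phi=\bar\phi\circ\psi$, and $F_{\bar h}\circ\Psi=F_h$. **Proposition.** Let $(\Psi,\psi)$ be a Hamiltonian morphism between the Hamiltonian systems $(E,\ldots,\phi,h)$ and $(\bar E,\ldots,\bar\phi,\bar h)$. Then there is a map $\widehat\Psi:V^*\to\bar V^*$ with the following properties. 1. $\widehat\Psi$ is a linear almost Poisson morphism over $\psi$: it is a vector bundle morphism over $\psi$ (so $\tau_{\bar V^*}\circ\widehat\Psi=\psi\circ\tau_{V^*}$), and $\{\bar G_1\circ\widehat\Psi,\bar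 G_2\circ\widehat\Psi\}_{V^*}=\{\bar G_1,\bar G_2\}_{\bar V^*}\circ\widehat\Psi$ for all $\bar G_1,\bar G_2\in C^\infty(\bar V^*)$. Moreover $\widehat\Psi\circ\mu=\bar\mu\circ\Psi$. 2. $R_h$ and $R_{\bar h}$ are $\widehat\Psi$-related: $R_{\bar h}\circ\widehat\Psi=T\widehat\Psi\circ R_h$. 3. If $\alpha\in\Gamma(V^*)$ and $\bar\alpha\in\Gamma(\bar V^*)$ satisfy $\widehat\Psi\circ\alpha=\bar\alpha\circ\psi$, then $R_h^\alpha$ and $R_{\bar h}^{\bar\alpha}$ are $\psi$-related: $R_{\bar h}^{\bar\alpha}\circ\psi=T\psi\circ R_h^\alpha$. -/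

import Mathlib

open Bundle Set Module
open scoped Manifold ContDiff Bundle

set_option linter.unusedSectionVars false

noncomputable section

namespace HamiltonJacobi

section
universe uB uQ uF uE
variable (B : Type uB) [NormedAddCommGroup B] [NormedSpace ℝ B]
  {Q : Type uQ} [TopologicalSpace Q] [ChartedSpace B Q]
  (F : Type uF) [NormedAddCommGroup F] [NormedSpace ℝ F]
  (E : Q → Type uE) [∀ q, AddCommGroup (E q)] [∀ q, Module ℝ (E q)]
  [∀ q, TopologicalSpace (E q)] [TopologicalSpace (TotalSpace F E)]
  [FiberBundle F E] [VectorBundle ℝ F E]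

/-- Smooth sections of the vector bundle `E` (typical fibre `F`) over a manifold `Q` modelled on `B`. -/
abbrev Sec := ContMDiffSection 𝓘(ℝ, B) F ∞ E

/-- The fibre `E_q^*` of the dual bundle. All fibres are finite-dimensional, so continuous linear
forms are the same as linear forms. -/
abbrev DualFiber (q : Q) : Type uE := E q →L[ℝ] ℝ
/-- The total space of the dual bundle `E^*`, with the manifold structure of Mathlib's bundle of
linear maps from `E` to the trivial line bundle. A point is a pair `⟨q, β⟩` with `β ∈ E_q^*`. -/
abbrev DualBundle := TotalSpace (F →L[ℝ] ℝ) (DualFiber E)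

/-- A smooth section `φ` of `E^*` whose restriction to every fibre `E_q` is nonzero. -/
structure NonvanishingCovector where
  toSec : Sec B (F →L[ℝ] ℝ) (DualFiber E)
  ne_zero : ∀ q, toSec q ≠ 0

/-- Typical fibre of the kernel of a nowhere vanishing section of the dual: a real vector space of
dimension one less. -/
abbrev KerModel (F : Type uF) [NormedAddCommGroup F] [NormedSpace ℝ F] : Type :=
  EuclideanSpace ℝ (Fin (finrank ℝ F - 1))

variable {B F E}

/-- The fibre `V_q = {e ∈ E_q | φ(q)(e) = 0}` of the vector subbundle `V = ker φ` of `E`. -/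
def KerFiber (φ : NonvanishingCovector B F E) (q : Q) : Type uE :=
  LinearMap.ker (φ.toSec q).toLinearMap

namespace KerFiber
variable (φ : NonvanishingCovector B F E)

instance (q : Q) : AddCommGroup (KerFiber φ q) :=
  inferInstanceAs (AddCommGroup (LinearMap.ker (φ.toSec q).toLinearMap))
instance (q : Q) : Module ℝ (KerFiber φ q) :=
  inferInstanceAs (Module ℝ (LinearMap.ker (φ.toSec q).toLinearMap))
instance (q : Q) : TopologicalSpace (KerFiber φ q) :=
  inferInstanceAs (TopologicalSpace (LinearMap.ker (φ.toSec q).toLinearMap))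

/-- The inclusion `i_V : V → E`, on the fibre over `q`. -/
def incl (q : Q) : KerFiber φ q →L[ℝ] E q :=
  (LinearMap.ker (φ.toSec q).toLinearMap).subtypeL

variable {φ}
theorem incl_injective (q : Q) : Function.Injective (incl φ q) := Subtype.val_injective
@[simp] theorem apply_incl {q : Q} (v : KerFiber φ q) : φ.toSec q (incl φ q v) = 0 :=
  LinearMap.mem_ker.1 v.2
/-- An element of the kernel as an element of `V_q`. -/
def mk {q : Q} (e : E q) (he : φ.toSec q e = 0) : KerFiber φ q := ⟨e, LinearMap.mem_ker.2 he⟩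
@[simp] theorem incl_mk {q : Q} (e : E q) (he : φ.toSec q e = 0) : incl φ q (mk e he) = e := rfl

end KerFiber

/-- A nonzero linear form splits its domain as a line plus its kernel. -/
theorem exists_splitting [FiniteDimensional ℝ F] {c : F →L[ℝ] ℝ} (hc : c ≠ 0) :
    ∃ (w : F) (P : F →L[ℝ] KerModel F) (J : KerModel F →L[ℝ] F),
      c w = 1 ∧ (∀ k, c (J k) = 0) ∧ (∀ k, P (J k) = k) ∧ (∀ y, J (P y) = y - c y • w) := by
  obtain ⟨w₀, hw₀⟩ : ∃ w, c w ≠ 0 := by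
    by_contra! h
    exact hc (ContinuousLinearMap.ext h)
  set w := (c w₀)⁻¹ • w₀ with hw
  have hcw : c w = 1 := by simp [hw, hw₀]
  have hsurj : Function.Surjective c.toLinearMap := fun r => ⟨r • w, by simp [hcw]⟩
  have hdim : finrank ℝ (LinearMap.ker c.toLinearMap) = finrank ℝ (KerModel F) := by
    have h1 := c.toLinearMap.finrank_range_add_finrank_ker
    rw [LinearMap.range_eq_top.2 hsurj, finrank_top, finrank_self] at h1
    rw [finrank_euclideanSpace_fin]
    omega
  let L := ContinuousLinearEquiv.ofFinrankEq hdim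
  let pr : F →L[ℝ] LinearMap.ker c.toLinearMap :=
    (ContinuousLinearMap.id ℝ F - c.smulRight w).codRestrict _ (fun y => by
      simp [hcw])
  refine ⟨w, L.toContinuousLinearMap.comp pr,
    (LinearMap.ker c.toLinearMap).subtypeL.comp L.symm.toContinuousLinearMap, hcw, ?_, ?_, ?_⟩
  · intro k
    exact LinearMap.mem_ker.1 (L.symm k).2
  · intro k
    have : pr (L.symm k : F) = L.symm k := by
      apply Subtype.ext
      have := LinearMap.mem_ker.1 (L.symm k).2
      simp only [ContinuousLinearMap.coe_coe] at this
      simp [pr, this]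
    simp [this]
  · intro y
    simp [pr]

theorem NonvanishingCovector.exists_eq_one (φ : NonvanishingCovector B F E) (q : Q) :
    ∃ x : E q, φ.toSec q x = 1 := by
  obtain ⟨x, hx⟩ : ∃ x, φ.toSec q x ≠ 0 := by
    by_contra! h
    exact φ.ne_zero q (ContinuousLinearMap.ext h)
  exact ⟨(φ.toSec q x)⁻¹ • x, by simp [hx]⟩

theorem NonvanishingCovector.smul_eq (φ : NonvanishingCovector B F E) {q : Q}
    {β : DualFiber E q} (hβ : β.comp (KerFiber.incl φ q) = 0) (e : E q) :
    φ.toSec q e • β = β e • φ.toSec q := by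
  ext x
  have h1 : φ.toSec q (φ.toSec q e • x - φ.toSec q x • e) = 0 := by
    simp [mul_comm]
  have h2 := congrArg (fun l => l (KerFiber.mk _ h1)) hβ
  simp only [ContinuousLinearMap.comp_apply, KerFiber.incl_mk, map_sub, map_smul,
    zero_apply, sub_eq_zero] at h2
  simpa [mul_comm] using h2

section Prebundle
variable [FiniteDimensional ℝ F] (φ : NonvanishingCovector B F E)

/-- The form `φ(q)` in the bundle chart of `E` around `q₀`. -/
def NonvanishingCovector.coord (q₀ q : Q) : F →L[ℝ] ℝ :=
  (φ.toSec q).comp ((trivializationAt F E q₀).symmL ℝ q)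

theorem NonvanishingCovector.coord_self_ne_zero (q₀ : Q) : φ.coord q₀ q₀ ≠ 0 := by
  intro h
  apply φ.ne_zero q₀
  ext e
  have := congrArg (fun l => l ((trivializationAt F E q₀).continuousLinearMapAt ℝ q₀ e)) h
  simpa [NonvanishingCovector.coord, Trivialization.symmL_continuousLinearMapAt,
    FiberBundle.mem_baseSet_trivializationAt'] using this

def kerW (q₀ : Q) : F := (exists_splitting (φ.coord_self_ne_zero q₀)).choose
def kerP (q₀ : Q) : F →L[ℝ] KerModel F :=
  (exists_splitting (φ.coord_self_ne_zero q₀)).choose_spec.choose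
def kerJ (q₀ : Q) : KerModel F →L[ℝ] F :=
  (exists_splitting (φ.coord_self_ne_zero q₀)).choose_spec.choose_spec.choose

theorem coord_kerW (q₀ : Q) : φ.coord q₀ q₀ (kerW φ q₀) = 1 :=
  (exists_splitting (φ.coord_self_ne_zero q₀)).choose_spec.choose_spec.choose_spec.1
theorem kerP_kerJ (q₀ : Q) (k : KerModel F) : kerP φ q₀ (kerJ φ q₀ k) = k :=
  (exists_splitting (φ.coord_self_ne_zero q₀)).choose_spec.choose_spec.choose_spec.2.2.1 k
theorem kerJ_kerP (q₀ : Q) (y : F) :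
    kerJ φ q₀ (kerP φ q₀ y) = y - φ.coord q₀ q₀ y • kerW φ q₀ :=
  (exists_splitting (φ.coord_self_ne_zero q₀)).choose_spec.choose_spec.choose_spec.2.2.2 y
theorem kerP_kerW (q₀ : Q) : kerP φ q₀ (kerW φ q₀) = 0 := by
  rw [← kerP_kerJ φ q₀ (kerP φ q₀ (kerW φ q₀)), kerJ_kerP, coord_kerW]
  simp

/-- The isomorphism from the typical fibre onto the kernel of `φ(q)`, in the chart of `E` around `q₀`. -/
def kerLift (q₀ q : Q) : KerModel F →L[ℝ] F :=
  kerJ φ q₀ - ((φ.coord q₀ q (kerW φ q₀))⁻¹ • (φ.coord q₀ q).comp (kerJ φ q₀)).smulRight (kerW φ q₀)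

/-- The open set around `q₀` over which `V` is trivialized. -/
def kerBase (q₀ : Q) : Set Q :=
  {q | q ∈ (trivializationAt F E q₀).baseSet ∧ φ.coord q₀ q (kerW φ q₀) ≠ 0}

theorem coord_kerLift {q₀ q : Q} (hq : q ∈ kerBase φ q₀) (k : KerModel F) :
    φ.toSec q ((trivializationAt F E q₀).symmL ℝ q (kerLift φ q₀ q k)) = 0 := by
  have h := hq.2
  change φ.coord q₀ q (kerLift φ q₀ q k) = 0
  simp only [kerLift, sub_apply, ContinuousLinearMap.smulRight_apply,
    smul_apply, ContinuousLinearMap.comp_apply, map_sub, map_smul, smul_eq_mul]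
  field_simp
  ring

theorem kerP_kerLift (q₀ q : Q) (k : KerModel F) : kerP φ q₀ (kerLift φ q₀ q k) = k := by
  simp [kerLift, kerP_kerJ, kerP_kerW]

theorem kerLift_kerP {q₀ q : Q} (hq : q ∈ kerBase φ q₀) (y : F) (hy : φ.coord q₀ q y = 0) :
    kerLift φ q₀ q (kerP φ q₀ y) = y := by
  have h := hq.2
  simp only [kerLift, sub_apply, ContinuousLinearMap.smulRight_apply,
    smul_apply, ContinuousLinearMap.comp_apply, kerJ_kerP, map_sub, map_smul,
    smul_eq_mul, hy]
  rw [sub_sub, ← add_smul]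
  have : φ.coord q₀ q₀ y + (φ.coord q₀ q (kerW φ q₀))⁻¹ *
      (0 - φ.coord q₀ q₀ y * φ.coord q₀ q (kerW φ q₀)) = 0 := by field_simp; ring
  rw [this]; simp

theorem mem_kerBase_self (q₀ : Q) : q₀ ∈ kerBase φ q₀ :=
  ⟨FiberBundle.mem_baseSet_trivializationAt' q₀, by rw [coord_kerW]; exact one_ne_zero⟩

variable [ContMDiffVectorBundle ∞ F E 𝓘(ℝ, B)]

theorem contMDiffOn_coord (q₀ : Q) :
    ContMDiffOn 𝓘(ℝ, B) 𝓘(ℝ, F →L[ℝ] ℝ) ∞ (φ.coord q₀) (trivializationAt F E q₀).baseSet := by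
  have h := (Bundle.Trivialization.contMDiffOn_section_baseSet_iff (IB := 𝓘(ℝ, B)) (n := ∞)
    (trivializationAt (F →L[ℝ] ℝ) (DualFiber E) q₀) (s := φ.toSec)).1 φ.toSec.contMDiff.contMDiffOn
  have hb : (trivializationAt (F →L[ℝ] ℝ) (DualFiber E) q₀).baseSet =
      (trivializationAt F E q₀).baseSet := by
    simp [hom_trivializationAt_baseSet]
  rw [hb] at h
  refine h.congr fun q hq => ?_
  rw [hom_trivializationAt_apply]
  ext y
  simp [ContinuousLinearMap.inCoordinates, NonvanishingCovector.coord]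

theorem isOpen_kerBase (q₀ : Q) : IsOpen (kerBase φ q₀) := by
  have h1 : ContinuousOn (fun q => φ.coord q₀ q (kerW φ q₀)) (trivializationAt F E q₀).baseSet :=
    ((contMDiffOn_coord φ q₀).continuousOn).clm_apply continuousOn_const
  exact h1.isOpen_inter_preimage (trivializationAt F E q₀).open_baseSet isOpen_ne

theorem contMDiffOn_kerLift (q₀ : Q) :
    ContMDiffOn 𝓘(ℝ, B) 𝓘(ℝ, KerModel F →L[ℝ] F) ∞ (kerLift φ q₀) (kerBase φ q₀) := by
  have h0 : ContMDiffOn 𝓘(ℝ, B) 𝓘(ℝ, F →L[ℝ] ℝ) ∞ (φ.coord q₀) (kerBase φ q₀) :=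
    (contMDiffOn_coord φ q₀).mono fun q hq => hq.1
  have h1 : ContMDiffOn 𝓘(ℝ, B) 𝓘(ℝ, ℝ) ∞ (fun q => φ.coord q₀ q (kerW φ q₀)) (kerBase φ q₀) :=
    h0.clm_apply contMDiffOn_const
  have h2 : ContMDiffOn 𝓘(ℝ, B) 𝓘(ℝ, ℝ) ∞ (fun q => (φ.coord q₀ q (kerW φ q₀))⁻¹)
      (kerBase φ q₀) := h1.inv₀ fun q hq => hq.2
  have h3 : ContMDiffOn 𝓘(ℝ, B) 𝓘(ℝ, KerModel F →L[ℝ] ℝ) ∞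
      (fun q => (φ.coord q₀ q).comp (kerJ φ q₀)) (kerBase φ q₀) :=
    h0.clm_comp contMDiffOn_const
  have h4 := h2.smul h3
  have h5 : ContMDiffOn 𝓘(ℝ, B) 𝓘(ℝ, KerModel F →L[ℝ] F) ∞
      (fun q => (ContinuousLinearMap.smulRightL ℝ (KerModel F) F).flip (kerW φ q₀)
        ((φ.coord q₀ q (kerW φ q₀))⁻¹ • (φ.coord q₀ q).comp (kerJ φ q₀))) (kerBase φ q₀) :=
    ((ContinuousLinearMap.contDiff _).contMDiff).comp_contMDiffOn h4
  exact contMDiffOn_const.sub h5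

/-- The local trivialization of `V` around `q₀`. -/
def kerPretriv (q₀ : Q) :
    Pretrivialization (KerModel F) (π (KerModel F) (KerFiber φ)) where
  toFun v := (v.1, kerP φ q₀ ((trivializationAt F E q₀).continuousLinearMapAt ℝ v.1
    (KerFiber.incl φ v.1 v.2)))
  invFun p := open Classical in
    ⟨p.1, if h : p.1 ∈ kerBase φ q₀ then KerFiber.mk _ (coord_kerLift φ h p.2) else 0⟩
  source := TotalSpace.proj ⁻¹' kerBase φ q₀
  target := kerBase φ q₀ ×ˢ univ
  map_source' v hv := ⟨hv, mem_univ _⟩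
  map_target' p hp := hp.1
  left_inv' := by
    rintro ⟨q, v⟩ hq
    change q ∈ kerBase φ q₀ at hq
    simp only [dif_pos hq]
    congr 1
    apply KerFiber.incl_injective
    rw [KerFiber.incl_mk, kerLift_kerP φ hq, Trivialization.symmL_continuousLinearMapAt _ hq.1]
    rw [NonvanishingCovector.coord, ContinuousLinearMap.comp_apply,
      Trivialization.symmL_continuousLinearMapAt _ hq.1, KerFiber.apply_incl]
  right_inv' := by
    rintro ⟨q, k⟩ ⟨hq, -⟩
    change q ∈ kerBase φ q₀ at hq
    simp only [dif_pos hq]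
    rw [KerFiber.incl_mk, Trivialization.continuousLinearMapAt_symmL _ hq.1, kerP_kerLift]
  open_target := (isOpen_kerBase φ q₀).prod isOpen_univ
  baseSet := kerBase φ q₀
  open_baseSet := isOpen_kerBase φ q₀
  source_eq := rfl
  target_eq := rfl
  proj_toFun _ _ := rfl

theorem kerPretriv_apply (q₀ : Q) (v : TotalSpace (KerModel F) (KerFiber φ)) :
    kerPretriv φ q₀ v = (v.1, kerP φ q₀ ((trivializationAt F E q₀).continuousLinearMapAt ℝ v.1
      (KerFiber.incl φ v.1 v.2))) := rfl

theorem kerLift_kerPretriv {q₀ q : Q} (hq : q ∈ kerBase φ q₀) (v : KerFiber φ q) :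
    kerLift φ q₀ q (kerPretriv φ q₀ ⟨q, v⟩).2 =
      (trivializationAt F E q₀).continuousLinearMapAt ℝ q (KerFiber.incl φ q v) := by
  rw [kerPretriv_apply]
  refine kerLift_kerP φ hq _ ?_
  rw [NonvanishingCovector.coord, ContinuousLinearMap.comp_apply,
    Trivialization.symmL_continuousLinearMapAt _ hq.1, KerFiber.apply_incl]

theorem incl_kerPretriv_symm {q₀ q : Q} (hq : q ∈ kerBase φ q₀) (k : KerModel F) :
    (trivializationAt F E q₀).continuousLinearMapAt ℝ q
      (KerFiber.incl φ q ((kerPretriv φ q₀).symm q k)) = kerLift φ q₀ q k := by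
  have h : kerPretriv φ q₀ ⟨q, (kerPretriv φ q₀).symm q k⟩ = (q, k) :=
    Pretrivialization.apply_mk_symm _ hq k
  rw [← kerLift_kerPretriv φ hq, h]

/-- Transition function between two local trivializations of `V`. -/
def kerTransition (q₀ q₁ q : Q) : KerModel F →L[ℝ] KerModel F :=
  (kerP φ q₁).comp (((trivializationAt F E q₀).coordChangeL ℝ (trivializationAt F E q₁) q :
    F →L[ℝ] F).comp (kerLift φ q₀ q))

theorem kerTransition_apply {q₀ q₁ q : Q} (hq : q ∈ kerBase φ q₀ ∩ kerBase φ q₁) (k : KerModel F) :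
    kerTransition φ q₀ q₁ q k = (kerPretriv φ q₁ ⟨q, (kerPretriv φ q₀).symm q k⟩).2 := by
  rw [kerPretriv_apply, kerTransition, ContinuousLinearMap.comp_apply,
    ContinuousLinearMap.comp_apply, ← incl_kerPretriv_symm φ hq.1]
  simp only [ContinuousLinearEquiv.coe_coe]
  rw [Trivialization.coordChangeL_apply _ _ ⟨hq.1.1, hq.2.1⟩,
    ← Trivialization.symmL_apply (R := ℝ) _ hq.1.1,
    Trivialization.symmL_continuousLinearMapAt _ hq.1.1,
    Trivialization.continuousLinearMapAt_apply, Trivialization.coe_linearMapAt_of_mem _ hq.2.1]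

theorem contMDiffOn_kerTransition (q₀ q₁ : Q) :
    ContMDiffOn 𝓘(ℝ, B) 𝓘(ℝ, KerModel F →L[ℝ] KerModel F) ∞ (kerTransition φ q₀ q₁)
      (kerBase φ q₀ ∩ kerBase φ q₁) := by
  have hsub : kerBase φ q₀ ∩ kerBase φ q₁ ⊆
      (trivializationAt F E q₀).baseSet ∩ (trivializationAt F E q₁).baseSet :=
    fun q hq => ⟨hq.1.1, hq.2.1⟩
  have h1 := (contMDiffOn_coordChangeL (IB := 𝓘(ℝ, B)) (n := ∞) (trivializationAt F E q₀)
    (trivializationAt F E q₁)).mono hsub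
  have h2 := (contMDiffOn_kerLift φ q₀).mono (inter_subset_left (t := kerBase φ q₁))
  exact contMDiffOn_const.clm_comp (h1.clm_comp h2)

/-- The smooth vector bundle structure of the subbundle `V` of `E`. -/
def kerPrebundle : VectorPrebundle ℝ (KerModel F) (KerFiber φ) where
  pretrivializationAtlas := range (kerPretriv φ)
  pretrivialization_linear' := by
    rintro _ ⟨q₀, rfl⟩
    exact ⟨fun q _ => ⟨fun v w => by simp [kerPretriv_apply], fun c v => by simp [kerPretriv_apply]⟩⟩
  pretrivializationAt := kerPretriv φ
  mem_base_pretrivializationAt := mem_kerBase_self φ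
  pretrivialization_mem_atlas q := ⟨q, rfl⟩
  exists_coordChange := by
    rintro _ ⟨q₀, rfl⟩ _ ⟨q₁, rfl⟩
    exact ⟨kerTransition φ q₀ q₁, (contMDiffOn_kerTransition φ q₀ q₁).continuousOn,
      fun q hq k => kerTransition_apply φ hq k⟩
  totalSpaceMk_isInducing q := by
    have hq := mem_kerBase_self φ q
    have h1 : Topology.IsInducing (fun v : KerFiber φ q => (kerPretriv φ q ⟨q, v⟩).2) := by
      have hi : Topology.IsInducing (fun v : KerFiber φ q =>
          (trivializationAt F E q).symmL ℝ q (kerLift φ q q (kerPretriv φ q ⟨q, v⟩).2)) := by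
        simp_rw [kerLift_kerPretriv φ hq, Trivialization.symmL_continuousLinearMapAt _ hq.1]
        exact Topology.IsInducing.subtypeVal
      refine Topology.IsInducing.of_comp (g := fun k => (trivializationAt F E q).symmL ℝ q
        (kerLift φ q q k)) ?_ ?_ hi
      · simp_rw [kerPretriv_apply]
        exact ((kerP φ q).continuous.comp (ContinuousLinearMap.continuous _)).comp
          (KerFiber.incl φ q).continuous
      · exact (ContinuousLinearMap.continuous _).comp (kerLift φ q q).continuous
    exact Topology.isInducing_const_prod.2 h1

instance : (kerPrebundle φ).IsContMDiff 𝓘(ℝ, B) ∞ where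
  exists_contMDiffCoordChange := by
    rintro _ ⟨q₀, rfl⟩ _ ⟨q₁, rfl⟩
    exact ⟨kerTransition φ q₀ q₁, contMDiffOn_kerTransition φ q₀ q₁,
      fun q hq k => kerTransition_apply φ hq k⟩

instance : TopologicalSpace (TotalSpace (KerModel F) (KerFiber φ)) :=
  (kerPrebundle φ).totalSpaceTopology
instance : FiberBundle (KerModel F) (KerFiber φ) := (kerPrebundle φ).toFiberBundle
instance : VectorBundle ℝ (KerModel F) (KerFiber φ) := (kerPrebundle φ).toVectorBundle
instance : ContMDiffVectorBundle ∞ (KerModel F) (KerFiber φ) 𝓘(ℝ, B) :=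
  (kerPrebundle φ).contMDiffVectorBundle 𝓘(ℝ, B)

theorem ker_trivializationAt_apply (q₀ : Q) (v : TotalSpace (KerModel F) (KerFiber φ)) :
    trivializationAt (KerModel F) (KerFiber φ) q₀ v = kerPretriv φ q₀ v := rfl

/-- The inclusion of `V` in `E` is smooth. -/
theorem KerFiber.contMDiff_incl : ContMDiff (𝓘(ℝ, B).prod 𝓘(ℝ, KerModel F)) (𝓘(ℝ, B).prod 𝓘(ℝ, F)) ∞
    (fun v : TotalSpace (KerModel F) (KerFiber φ) =>
      (⟨v.1, KerFiber.incl φ v.1 v.2⟩ : TotalSpace F E)) := by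
  intro v₀
  have hp : ContMDiffAt (𝓘(ℝ, B).prod 𝓘(ℝ, KerModel F)) 𝓘(ℝ, B) ∞
    (fun v : TotalSpace (KerModel F) (KerFiber φ) => v.1) v₀ := contMDiffAt_proj _
  rw [contMDiffAt_totalSpace]
  refine ⟨hp, ?_⟩
  have hU : ∀ᶠ v in nhds v₀, v.1 ∈ kerBase φ v₀.1 :=
    hp.continuousAt.eventually_mem ((isOpen_kerBase φ v₀.1).mem_nhds (mem_kerBase_self φ v₀.1))
  have h1 : ContMDiffAt (𝓘(ℝ, B).prod 𝓘(ℝ, KerModel F)) 𝓘(ℝ, KerModel F) ∞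
      (fun v => (trivializationAt (KerModel F) (KerFiber φ) v₀.1 v).2) v₀ :=
    (contMDiffAt_totalSpace.1 contMDiffAt_id).2
  have h2 : ContMDiffAt (𝓘(ℝ, B).prod 𝓘(ℝ, KerModel F)) 𝓘(ℝ, KerModel F →L[ℝ] F) ∞
      (fun v : TotalSpace (KerModel F) (KerFiber φ) => kerLift φ v₀.1 v.1) v₀ :=
    ((contMDiffOn_kerLift φ v₀.1).contMDiffAt
      ((isOpen_kerBase φ v₀.1).mem_nhds (mem_kerBase_self φ v₀.1))).comp v₀ hp
  refine (h2.clm_apply h1).congr_of_eventuallyEq ?_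
  filter_upwards [hU] with v hv
  rw [ker_trivializationAt_apply, kerLift_kerPretriv φ hv,
    Trivialization.continuousLinearMapAt_apply, Trivialization.coe_linearMapAt_of_mem _ hv.1]

/-- A section of `V` is smooth as soon as it is smooth as a section of `E`. -/
theorem KerFiber.contMDiff_section {s : ∀ q, KerFiber φ q}
    (hs : ContMDiff 𝓘(ℝ, B) (𝓘(ℝ, B).prod 𝓘(ℝ, F)) ∞
      (fun q => (⟨q, KerFiber.incl φ q (s q)⟩ : TotalSpace F E))) :
    ContMDiff 𝓘(ℝ, B) (𝓘(ℝ, B).prod 𝓘(ℝ, KerModel F)) ∞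
      (fun q => (⟨q, s q⟩ : TotalSpace (KerModel F) (KerFiber φ))) := by
  intro q₀
  rw [contMDiffAt_section]
  have h1 := (contMDiffAt_section q₀).1 (hs q₀)
  have h2 : ContMDiffAt 𝓘(ℝ, B) 𝓘(ℝ, F →L[ℝ] KerModel F) ∞ (fun _ => kerP φ q₀) q₀ :=
    contMDiffAt_const
  refine (h2.clm_apply h1).congr_of_eventuallyEq ?_
  filter_upwards [(isOpen_kerBase φ q₀).mem_nhds (mem_kerBase_self φ q₀)] with q hq
  rw [ker_trivializationAt_apply, kerPretriv_apply,
    Trivialization.continuousLinearMapAt_apply, Trivialization.coe_linearMapAt_of_mem _ hq.1]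

end Prebundle
end

section
universe uB uQ uF uE
variable {B : Type uB} [NormedAddCommGroup B] [NormedSpace ℝ B]
  {Q : Type uQ} [TopologicalSpace Q] [ChartedSpace B Q]
  {F : Type uF} [NormedAddCommGroup F] [NormedSpace ℝ F]
  {E : Q → Type uE} [∀ q, AddCommGroup (E q)] [∀ q, Module ℝ (E q)]
  [∀ q, TopologicalSpace (E q)] [TopologicalSpace (TotalSpace F E)]
  [FiberBundle F E] [VectorBundle ℝ F E]

/-- The product `f σ` of a smooth function and a smooth section. -/
def Sec.fmul (f : C^∞⟮𝓘(ℝ, B), Q; ℝ⟯) (σ : Sec B F E) : Sec B F E :=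
  ⟨fun q => f q • σ q, f.contMDiff.smul_section σ.contMDiff⟩

@[simp] theorem Sec.fmul_apply (f : C^∞⟮𝓘(ℝ, B), Q; ℝ⟯) (σ : Sec B F E) (q : Q) :
    Sec.fmul f σ q = f q • σ q := rfl

section through
variable [IsManifold 𝓘(ℝ, B) ∞ Q] [FiniteDimensional ℝ B] [T2Space Q]
  [ContMDiffVectorBundle ∞ F E 𝓘(ℝ, B)]

variable (B F) in
/-- A smooth bump function at `q`, equal to one near `q` and supported in the domain of the bundle
chart of `E` at `q`. -/
def bump (E : Q → Type uE) [∀ q, AddCommGroup (E q)] [∀ q, Module ℝ (E q)]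
  [∀ q, TopologicalSpace (E q)] [TopologicalSpace (TotalSpace F E)]
  [FiberBundle F E] [VectorBundle ℝ F E] (q : Q) : SmoothBumpFunction 𝓘(ℝ, B) q :=
  ((SmoothBumpFunction.nhds_basis_tsupport (I := 𝓘(ℝ, B)) q).mem_iff.1
    ((trivializationAt F E q).open_baseSet.mem_nhds
      (FiberBundle.mem_baseSet_trivializationAt' q))).choose

theorem tsupport_bump (q : Q) :
    tsupport (bump B F E q) ⊆ (trivializationAt F E q).baseSet :=
  ((SmoothBumpFunction.nhds_basis_tsupport (I := 𝓘(ℝ, B)) q).mem_iff.1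
    ((trivializationAt F E q).open_baseSet.mem_nhds
      (FiberBundle.mem_baseSet_trivializationAt' q))).choose_spec.2

variable (B F) in
/-- A global smooth section of `E` with a prescribed value at `q`, depending linearly on that value. -/
def through (q : Q) : E q →ₗ[ℝ] Sec B F E where
  toFun v := ⟨fun p => bump B F E q p • (trivializationAt F E q).symmL ℝ p
      ((trivializationAt F E q).continuousLinearMapAt ℝ q v), by
    refine ContMDiffOn.smul_section_of_tsupport (u := (trivializationAt F E q).baseSet)
      (bump B F E q).contMDiff.contMDiffOn (trivializationAt F E q).open_baseSet
      (tsupport_bump q) ?_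
    rw [Bundle.Trivialization.contMDiffOn_section_baseSet_iff]
    refine (contMDiffOn_const
      (c := (trivializationAt F E q).continuousLinearMapAt ℝ q v)).congr fun p hp => ?_
    rw [Trivialization.symmL_apply _ hp, Trivialization.apply_mk_symm _ hp]⟩
  map_add' v w := by ext p; simp
  map_smul' c v := by ext p; simp [smul_comm c]

@[simp] theorem through_self (q : Q) (v : E q) : through B F q v q = v := by
  change bump B F E q q • (trivializationAt F E q).symmL ℝ q
    ((trivializationAt F E q).continuousLinearMapAt ℝ q v) = v
  rw [SmoothBumpFunction.eq_one, one_smul,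
    Trivialization.symmL_continuousLinearMapAt _ (FiberBundle.mem_baseSet_trivializationAt' q)]

end through

variable (B F E) in
/-- A skew-symmetric algebroid structure on the vector bundle `E → Q`: a skew-symmetric `ℝ`-bilinear
bracket on the smooth sections of `E` and an anchor map `ρ : E → TQ` (a smooth morphism of vector
bundles over the identity) with `⟦σ, f γ⟧ = f ⟦σ, γ⟧ + ρ(σ)(f) γ`. No Jacobi identity is required. -/
structure SkewAlgebroid [IsManifold 𝓘(ℝ, B) ∞ Q] where
  bracket : Sec B F E →ₗ[ℝ] Sec B F E →ₗ[ℝ] Sec B F E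
  bracket_skew : ∀ σ γ, bracket σ γ = - bracket γ σ
  anchor : ∀ q, E q →ₗ[ℝ] TangentSpace 𝓘(ℝ, B) q
  contMDiff_anchor : ContMDiff (𝓘(ℝ, B).prod 𝓘(ℝ, F)) 𝓘(ℝ, B).tangent ∞
    (fun v : TotalSpace F E => (⟨v.1, anchor v.1 v.2⟩ : TangentBundle 𝓘(ℝ, B) Q))
  leibniz : ∀ (σ γ : Sec B F E) (f : C^∞⟮𝓘(ℝ, B), Q; ℝ⟯) (q : Q),
    bracket σ (Sec.fmul f γ) q =
      f q • bracket σ γ q + mvfderiv 𝓘(ℝ, B) f q (anchor q (σ q)) • γ q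

section
variable [IsManifold 𝓘(ℝ, B) ∞ Q]

/-- The almost differential of a section `α` of `E^*`:
`(d^E α)(σ, γ) = ρ(σ)(α(γ)) - ρ(γ)(α(σ)) - α(⟦σ, γ⟧)`. -/
def SkewAlgebroid.dOne (A : SkewAlgebroid B F E) (α : ∀ q, DualFiber E q) (σ γ : Sec B F E)
    (q : Q) : ℝ :=
  mvfderiv 𝓘(ℝ, B) (fun p => α p (γ p)) q (A.anchor q (σ q))
    - mvfderiv 𝓘(ℝ, B) (fun p => α p (σ p)) q (A.anchor q (γ q))
    - α q (A.bracket σ γ q)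

/-- The section `φ` of `E^*` is a `1`-cocycle: `d^E φ = 0`. -/
def SkewAlgebroid.IsCocycle (A : SkewAlgebroid B F E) (φ : Sec B (F →L[ℝ] ℝ) (DualFiber E)) :
    Prop := ∀ (σ γ : Sec B F E) (q : Q), A.dOne φ σ γ q = 0

section ker
variable [FiniteDimensional ℝ F] [ContMDiffVectorBundle ∞ F E 𝓘(ℝ, B)]
  {φ : NonvanishingCovector B F E}

/-- Sections of `V` seen as sections of `E`. -/
def KerFiber.inclSec (φ : NonvanishingCovector B F E) :
    Sec B (KerModel F) (KerFiber φ) →ₗ[ℝ] Sec B F E where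
  toFun σ := ⟨fun q => KerFiber.incl φ q (σ q), (KerFiber.contMDiff_incl φ).comp σ.contMDiff⟩
  map_add' σ γ := by ext q; simp
  map_smul' c σ := by ext q; simp

@[simp] theorem KerFiber.inclSec_apply (σ : Sec B (KerModel F) (KerFiber φ)) (q : Q) :
    KerFiber.inclSec φ σ q = KerFiber.incl φ q (σ q) := rfl

theorem SkewAlgebroid.IsCocycle.apply_bracket {A : SkewAlgebroid B F E}
    (hφ : A.IsCocycle φ.toSec) (σ γ : Sec B (KerModel F) (KerFiber φ)) (q : Q) :
    φ.toSec q (A.bracket (KerFiber.inclSec φ σ) (KerFiber.inclSec φ γ) q) = 0 := by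
  have h := hφ (KerFiber.inclSec φ σ) (KerFiber.inclSec φ γ) q
  simpa [SkewAlgebroid.dOne, mvfderiv_const] using h

/-- The bracket of `E` restricted to sections of `V`. -/
def SkewAlgebroid.restrictBracket (A : SkewAlgebroid B F E) (hφ : A.IsCocycle φ.toSec)
    (σ γ : Sec B (KerModel F) (KerFiber φ)) : Sec B (KerModel F) (KerFiber φ) :=
  ⟨fun q => KerFiber.mk (A.bracket (KerFiber.inclSec φ σ) (KerFiber.inclSec φ γ) q)
    (hφ.apply_bracket σ γ q),
    KerFiber.contMDiff_section φ
      (A.bracket (KerFiber.inclSec φ σ) (KerFiber.inclSec φ γ)).contMDiff⟩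

@[simp] theorem SkewAlgebroid.incl_restrictBracket (A : SkewAlgebroid B F E)
    (hφ : A.IsCocycle φ.toSec) (σ γ : Sec B (KerModel F) (KerFiber φ)) (q : Q) :
    KerFiber.incl φ q (A.restrictBracket hφ σ γ q) =
      A.bracket (KerFiber.inclSec φ σ) (KerFiber.inclSec φ γ) q := rfl

/-- The skew-symmetric algebroid structure induced on `V = ker φ` by a `1`-cocycle `φ`:
`i_V ⟦σ, γ⟧_V = ⟦i_V σ, i_V γ⟧` and `ρ_V = ρ ∘ i_V`. -/
def SkewAlgebroid.restrict (A : SkewAlgebroid B F E) (hφ : A.IsCocycle φ.toSec) :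
    SkewAlgebroid B (KerModel F) (KerFiber φ) where
  bracket := LinearMap.mk₂ ℝ (A.restrictBracket hφ)
    (fun σ σ' γ => by ext q; apply KerFiber.incl_injective; simp)
    (fun c σ γ => by ext q; apply KerFiber.incl_injective; simp)
    (fun σ γ γ' => by ext q; apply KerFiber.incl_injective; simp)
    (fun c σ γ => by ext q; apply KerFiber.incl_injective; simp)
  bracket_skew σ γ := by
    ext q
    apply KerFiber.incl_injective
    simp only [LinearMap.mk₂_apply, ContMDiffSection.coe_neg, Pi.neg_apply, map_neg,
      SkewAlgebroid.incl_restrictBracket]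
    rw [A.bracket_skew]
    rfl
  anchor q := A.anchor q ∘ₗ (KerFiber.incl φ q).toLinearMap
  contMDiff_anchor := A.contMDiff_anchor.comp (KerFiber.contMDiff_incl φ)
  leibniz σ γ f q := by
    apply KerFiber.incl_injective
    have h : KerFiber.inclSec φ (Sec.fmul f γ) = Sec.fmul f (KerFiber.inclSec φ γ) := by
      ext q; simp
    simp only [LinearMap.mk₂_apply, SkewAlgebroid.incl_restrictBracket, h, A.leibniz, map_add,
      map_smul]
    rfl

/-- The restriction of linear forms, `E_q^* → V_q^*`. -/
def muFiber (φ : NonvanishingCovector B F E) {q : Q} (β : DualFiber E q) :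
    DualFiber (KerFiber φ) q :=
  β.comp (KerFiber.incl φ q)

/-- The map `μ = i_V^* : E^* → V^*`. -/
def mu (φ : NonvanishingCovector B F E) (α : DualBundle F E) :
    DualBundle (KerModel F) (KerFiber φ) :=
  ⟨α.1, muFiber φ α.2⟩

end ker

/-- The derivative of `G : E^* → ℝ` at `α` in the vertical direction `β`. -/
def vertDeriv (G : DualBundle F E → ℝ) (α : DualBundle F E) (β : DualFiber E α.1) : ℝ :=
  deriv (fun t : ℝ => G ⟨α.1, α.2 + t • β⟩) 0

open Classical in
/-- The fibre derivative of `G : E^* → ℝ` at `α ∈ E_q^*`, as an element of `E_q`: the vector `x` with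
`β(x) = d/dt G(α + t β)` at `t = 0` for all `β ∈ E_q^*`. It exists when `G` is differentiable
(`exists_fiberDeriv`). -/
def fiberDeriv (G : DualBundle F E → ℝ) (α : DualBundle F E) : E α.1 :=
  if h : ∃ x : E α.1, ∀ β : DualFiber E α.1, β x = vertDeriv G α β then h.choose else 0

theorem fiberDeriv_congr {E' : Q → Type uE} [∀ q, AddCommGroup (E' q)]
    [∀ q, Module ℝ (E' q)] [∀ q, TopologicalSpace (E' q)] {G H : DualBundle F E' → ℝ} {q : Q}
    {a a' : DualFiber E' q} (h : ∀ β, vertDeriv G ⟨q, a⟩ β = vertDeriv H ⟨q, a'⟩ β) :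
    fiberDeriv G ⟨q, a⟩ = fiberDeriv H ⟨q, a'⟩ := by
  have key : ∀ f g : DualFiber E' q → ℝ, f = g →
      (open Classical in if h : ∃ x : E' q, ∀ β : DualFiber E' q, β x = f β then h.choose else 0) =
      (open Classical in if h : ∃ x : E' q, ∀ β : DualFiber E' q, β x = g β then h.choose else 0) := by
    rintro f _ rfl
    rfl
  exact key _ _ (funext h)

section poisson
variable [FiniteDimensional ℝ B] [T2Space Q] [ContMDiffVectorBundle ∞ F E 𝓘(ℝ, B)]

/-- Auxiliary expression for the almost Poisson bracket at the point `s(q)`, by means of a section `s`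
of `E^*`: with `x`, `y` the fibre derivatives of `G`, `H` at `s(q)`, it is
`(d^E s)(x, y) + ρ(y)(G ∘ s) - ρ(x)(H ∘ s)`. It depends only on the value of `s` at `q`
(`SkewAlgebroid.poissonAlong_congr`). -/
def SkewAlgebroid.poissonAlong (A : SkewAlgebroid B F E) (s : ∀ q, DualFiber E q)
    (G H : DualBundle F E → ℝ) (q : Q) : ℝ :=
  A.dOne s (through B F q (fiberDeriv G ⟨q, s q⟩)) (through B F q (fiberDeriv H ⟨q, s q⟩)) q
    + mvfderiv 𝓘(ℝ, B) (fun p => G ⟨p, s p⟩) q (A.anchor q (fiberDeriv H ⟨q, s q⟩))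
    - mvfderiv 𝓘(ℝ, B) (fun p => H ⟨p, s p⟩) q (A.anchor q (fiberDeriv G ⟨q, s q⟩))

/-- The linear almost Poisson bracket `{G, H}` on `E^*` of a skew-symmetric algebroid, computed along
any section through the given point (`SkewAlgebroid.poisson_eq`). It is the unique bracket that is
skew-symmetric, bilinear and a derivation in each argument, with `{σ^, γ^} = -⟦σ, γ⟧^`,
`{f ∘ τ, σ^} = ρ(σ)(f) ∘ τ` and `{f ∘ τ, g ∘ τ} = 0`, where `σ^` is the linear function on `E^*`
defined by the section `σ`. These properties are proved below: `SkewAlgebroid.poisson_skew`,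
`SkewAlgebroid.poisson_add_right`, `SkewAlgebroid.poisson_mul_right`,
`SkewAlgebroid.poisson_hat_hat`, `SkewAlgebroid.poisson_base_hat`,
`SkewAlgebroid.poisson_base_base`. -/
def SkewAlgebroid.poisson (A : SkewAlgebroid B F E) (G H : DualBundle F E → ℝ)
    (α : DualBundle F E) : ℝ :=
  A.poissonAlong (through B (F →L[ℝ] ℝ) α.1 α.2 : Sec B (F →L[ℝ] ℝ) (DualFiber E)) G H α.1

end poisson
end
end

section
universe uB uQ uF uE
variable {B : Type uB} [NormedAddCommGroup B] [NormedSpace ℝ B]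
  {Q : Type uQ} [TopologicalSpace Q] [ChartedSpace B Q]
  {F : Type uF} [NormedAddCommGroup F] [NormedSpace ℝ F]
  {E : Q → Type uE} [∀ q, AddCommGroup (E q)] [∀ q, Module ℝ (E q)]
  [∀ q, TopologicalSpace (E q)] [TopologicalSpace (TotalSpace F E)]
  [FiberBundle F E] [VectorBundle ℝ F E]

theorem contMDiff_fiberMk (q : Q) : ContMDiff 𝓘(ℝ, F) (𝓘(ℝ, B).prod 𝓘(ℝ, F)) ∞
    (fun w : F => (⟨q, (trivializationAt F E q).symmL ℝ q w⟩ : TotalSpace F E)) := by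
  intro w
  rw [contMDiffAt_totalSpace]
  refine ⟨contMDiffAt_const, ?_⟩
  refine contMDiffAt_id.congr_of_eventuallyEq (Filter.Eventually.of_forall fun w' => ?_)
  have hq : q ∈ (trivializationAt F E q).baseSet := FiberBundle.mem_baseSet_trivializationAt' q
  change (trivializationAt F E q ⟨q, (trivializationAt F E q).symmL ℝ q w'⟩).2 = w'
  rw [Trivialization.symmL_apply _ hq, Trivialization.apply_mk_symm _ hq]

theorem fiber_line (q : Q) (a b : E q) (t : ℝ) :
    a + t • b = (trivializationAt F E q).symmL ℝ q
      ((trivializationAt F E q).continuousLinearMapAt ℝ q a +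
        t • (trivializationAt F E q).continuousLinearMapAt ℝ q b) := by
  rw [map_add, map_smul,
    Trivialization.symmL_continuousLinearMapAt _ (FiberBundle.mem_baseSet_trivializationAt' q),
    Trivialization.symmL_continuousLinearMapAt _ (FiberBundle.mem_baseSet_trivializationAt' q)]

variable (B) in
theorem contMDiff_fiber_line (q : Q) (a b : E q) :
    ContMDiff 𝓘(ℝ, ℝ) (𝓘(ℝ, B).prod 𝓘(ℝ, F)) ∞
    (fun t : ℝ => (⟨q, a + t • b⟩ : TotalSpace F E)) := by
  simp_rw [fiber_line (F := F) q a b]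
  refine (contMDiff_fiberMk q).comp (ContDiff.contMDiff ?_)
  fun_prop

theorem vertDeriv_eq_fderiv {G : DualBundle F E → ℝ} {α : DualBundle F E}
    (hG : MDifferentiableAt (𝓘(ℝ, B).prod 𝓘(ℝ, F →L[ℝ] ℝ)) 𝓘(ℝ, ℝ) G α)
    (β : DualFiber E α.1) :
    vertDeriv G α β = fderiv ℝ (fun w => G ⟨α.1,
        (trivializationAt (F →L[ℝ] ℝ) (DualFiber E) α.1).symmL ℝ α.1 w⟩)
      ((trivializationAt (F →L[ℝ] ℝ) (DualFiber E) α.1).continuousLinearMapAt ℝ α.1 α.2)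
      ((trivializationAt (F →L[ℝ] ℝ) (DualFiber E) α.1).continuousLinearMapAt ℝ α.1 β) := by
  obtain ⟨q, a⟩ := α
  set e := trivializationAt (F →L[ℝ] ℝ) (DualFiber E) q with he
  have hq : q ∈ e.baseSet := FiberBundle.mem_baseSet_trivializationAt' q
  have h1 : DifferentiableAt ℝ (fun w => G ⟨q, e.symmL ℝ q w⟩) (e.continuousLinearMapAt ℝ q a) := by
    rw [← mdifferentiableAt_iff_differentiableAt]
    refine MDifferentiableAt.comp (I' := 𝓘(ℝ, B).prod 𝓘(ℝ, F →L[ℝ] ℝ)) (g := G) _ ?_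
      ((contMDiff_fiberMk (B := B) q).mdifferentiable (by simp) _)
    rw [Trivialization.symmL_continuousLinearMapAt _ hq]
    exact hG
  have h2 : HasDerivAt (fun t : ℝ => e.continuousLinearMapAt ℝ q a +
      t • e.continuousLinearMapAt ℝ q β) (e.continuousLinearMapAt ℝ q β) 0 := by
    simpa using ((hasDerivAt_id (0 : ℝ)).smul_const
      (e.continuousLinearMapAt ℝ q β)).const_add (e.continuousLinearMapAt ℝ q a)
  have h3 : deriv (fun t : ℝ => G ⟨q, e.symmL ℝ q (e.continuousLinearMapAt ℝ q a +
      t • e.continuousLinearMapAt ℝ q β)⟩) 0 =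
      fderiv ℝ (fun w => G ⟨q, e.symmL ℝ q w⟩) (e.continuousLinearMapAt ℝ q a)
        (e.continuousLinearMapAt ℝ q β) :=
    (HasFDerivAt.comp_hasDerivAt (x := (0 : ℝ))
      (l := fun w => G ⟨q, e.symmL ℝ q w⟩) (by simpa only [zero_smul, add_zero] using
        h1.hasFDerivAt) h2).deriv
  refine Eq.trans ?_ h3
  rw [vertDeriv]
  congr 1
  funext t
  rw [fiber_line (F := F →L[ℝ] ℝ) q a β t]

theorem exists_fiberDeriv [FiniteDimensional ℝ F] {G : DualBundle F E → ℝ} {α : DualBundle F E}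
    (hG : MDifferentiableAt (𝓘(ℝ, B).prod 𝓘(ℝ, F →L[ℝ] ℝ)) 𝓘(ℝ, ℝ) G α) :
    ∃ x : E α.1, ∀ β : DualFiber E α.1, β x = vertDeriv G α β := by
  simp_rw [vertDeriv_eq_fderiv hG]
  set ℓ := fderiv ℝ (fun w => G ⟨α.1,
        (trivializationAt (F →L[ℝ] ℝ) (DualFiber E) α.1).symmL ℝ α.1 w⟩)
      ((trivializationAt (F →L[ℝ] ℝ) (DualFiber E) α.1).continuousLinearMapAt ℝ α.1 α.2)
  obtain ⟨y, hy⟩ : ∃ y : F, ∀ w : F →L[ℝ] ℝ, ℓ w = w y := by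
    refine ⟨(Module.evalEquiv ℝ F).symm
      (ℓ.toLinearMap ∘ₗ (LinearMap.toContinuousLinearMap (𝕜 := ℝ) (E := F) (F' := ℝ)).toLinearMap),
      fun w => ?_⟩
    have := Module.apply_evalEquiv_symm_apply (R := ℝ) (M := F) w.toLinearMap
      (ℓ.toLinearMap ∘ₗ (LinearMap.toContinuousLinearMap (𝕜 := ℝ) (E := F) (F' := ℝ)).toLinearMap)
    simp only [ContinuousLinearMap.coe_coe] at this
    rw [this]
    rfl
  refine ⟨(trivializationAt F E α.1).symmL ℝ α.1 y, fun β => ?_⟩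
  have hq : α.1 ∈ (trivializationAt (F →L[ℝ] ℝ) (DualFiber E) α.1).baseSet :=
    FiberBundle.mem_baseSet_trivializationAt' _
  rw [hy, Trivialization.continuousLinearMapAt_apply, Trivialization.coe_linearMapAt_of_mem _ hq]
  change _ = (trivializationAt (F →L[ℝ] ℝ) (DualFiber E) α.1 ⟨α.1, β⟩).2 y
  rw [hom_trivializationAt_apply]
  simp [ContinuousLinearMap.inCoordinates]

theorem apply_fiberDeriv [FiniteDimensional ℝ F] {G : DualBundle F E → ℝ} {α : DualBundle F E}
    (hG : MDifferentiableAt (𝓘(ℝ, B).prod 𝓘(ℝ, F →L[ℝ] ℝ)) 𝓘(ℝ, ℝ) G α) (β : DualFiber E α.1) :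
    β (fiberDeriv G α) = vertDeriv G α β := by
  have h := exists_fiberDeriv hG
  rw [fiberDeriv, dif_pos h]
  exact h.choose_spec β

theorem eq_of_forall_dual {q : Q} {x y : E q} (h : ∀ β : DualFiber E q, β x = β y) (F : Type uF) [NormedAddCommGroup F] [NormedSpace ℝ F] [TopologicalSpace (TotalSpace F E)]
  [FiberBundle F E] [VectorBundle ℝ F E] [FiniteDimensional ℝ F] : x = y := by
  have hq : q ∈ (trivializationAt F E q).baseSet := FiberBundle.mem_baseSet_trivializationAt' _
  rw [← Trivialization.symmL_continuousLinearMapAt (R := ℝ) _ hq x,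
    ← Trivialization.symmL_continuousLinearMapAt (R := ℝ) _ hq y]
  congr 1
  by_contra hne
  obtain ⟨f, hf⟩ := SeparatingDual.exists_separating_of_ne (R := ℝ) hne
  exact hf (h (f.comp ((trivializationAt F E q).continuousLinearMapAt ℝ q)))

section
variable [ContMDiffVectorBundle ∞ F E 𝓘(ℝ, B)]

theorem exists_mvfderiv_comp_section {K : TotalSpace F E → ℝ} (z : TotalSpace F E)
    (hK : MDifferentiableAt (𝓘(ℝ, B).prod 𝓘(ℝ, F)) 𝓘(ℝ, ℝ) K z) :
    ∃ D : B × F →L[ℝ] ℝ,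
      (∀ (s : Sec B F E), s z.1 = z.2 → ∀ u : B,
        mvfderiv 𝓘(ℝ, B) (fun p => K ⟨p, s p⟩) z.1 u = D (u, mvfderiv 𝓘(ℝ, B)
          (fun p => (trivializationAt F E z.1 ⟨p, s p⟩).2) z.1 u)) ∧
      (∀ w : F, D (0, w) = deriv (fun t : ℝ => K ⟨z.1, z.2 + t •
        (trivializationAt F E z.1).symmL ℝ z.1 w⟩) 0) := by
  obtain ⟨q, a⟩ := z
  set e := trivializationAt F E q with he
  have hq : q ∈ e.baseSet := FiberBundle.mem_baseSet_trivializationAt' q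
  set w₀ := (e ⟨q, a⟩).2 with hw₀
  have hmem : ((q, w₀) : Q × F) ∈ e.target := by
    rw [Trivialization.mem_target]; exact hq
  have hsymm : e.toOpenPartialHomeomorph.symm (q, w₀) = ⟨q, a⟩ := by
    have h1 : e ⟨q, a⟩ = (q, w₀) := by
      ext
      · exact e.coe_fst' hq
      · rfl
    rw [← h1]
    exact e.toOpenPartialHomeomorph.left_inv (by rw [e.mem_source]; exact hq)
  have h2 : MDifferentiableAt (𝓘(ℝ, B).prod 𝓘(ℝ, F)) 𝓘(ℝ, ℝ)
      (fun x : Q × F => K (e.toOpenPartialHomeomorph.symm x)) (q, w₀) := by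
    refine MDifferentiableAt.comp (I' := 𝓘(ℝ, B).prod 𝓘(ℝ, F)) (g := K) _ (by rw [hsymm]; exact hK)
      ?_
    exact ((e.contMDiffOn_symm (IB := 𝓘(ℝ, B)) (n := ∞)).contMDiffAt
      (e.open_target.mem_nhds hmem)).mdifferentiableAt (by simp)
  refine ⟨mvfderiv (𝓘(ℝ, B).prod 𝓘(ℝ, F)) (fun x : Q × F => K (e.toOpenPartialHomeomorph.symm x))
    (q, w₀), ?_, ?_⟩
  · intro s hs u
    have hs' : s q = a := hs
    have h3 : MDifferentiableAt 𝓘(ℝ, B) 𝓘(ℝ, F) (fun p => (e ⟨p, s p⟩).2) q :=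
      ((contMDiffAt_section q).1 (s.contMDiff q)).mdifferentiableAt (by simp)
    have h4 : (fun p => K ⟨p, s p⟩) =ᶠ[nhds q]
        (fun x : Q × F => K (e.toOpenPartialHomeomorph.symm x)) ∘
          (fun p => (p, (e ⟨p, s p⟩).2)) := by
      filter_upwards [e.open_baseSet.mem_nhds hq] with p hp
      have h1 : e ⟨p, s p⟩ = (p, (e ⟨p, s p⟩).2) := by
        ext
        · exact e.coe_fst' hp
        · rfl
      simp only [Function.comp_apply]
      rw [← h1]
      congr 1
      exact (e.toOpenPartialHomeomorph.left_inv (by rw [e.mem_source]; exact hp)).symm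
    have h5 : HasMFDerivAt 𝓘(ℝ, B) (𝓘(ℝ, B).prod 𝓘(ℝ, F)) (fun p => (p, (e ⟨p, s p⟩).2)) q _ :=
      (hasMFDerivAt_id q).prodMk h3.hasMFDerivAt
    have h6 : ((q, (e ⟨q, s q⟩).2) : Q × F) = (q, w₀) := by rw [hs']
    have h7 := (HasMFDerivAt.comp q (g := fun x : Q × F => K (e.toOpenPartialHomeomorph.symm x))
      (by rw [h6]; exact h2.hasMFDerivAt) h5).congr_of_eventuallyEq h4
    have h8 := h7.mfderiv
    change mfderiv 𝓘(ℝ, B) 𝓘(ℝ, ℝ) (fun p => K ⟨p, s p⟩) q u = _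
    rw [h8]
    rfl
  · intro w
    have h3 : HasMFDerivAt 𝓘(ℝ, ℝ) (𝓘(ℝ, B).prod 𝓘(ℝ, F)) (fun t : ℝ => (q, w₀ + t • w)) 0 _ :=
      (hasMFDerivAt_const q (0 : ℝ)).prodMk
        (HasDerivAt.hasFDerivAt (f := fun t : ℝ => w₀ + t • w) (f' := w) (x := 0) (by
          simpa using ((hasDerivAt_id (0 : ℝ)).smul_const w).const_add w₀)).hasMFDerivAt
    have h6 : ((q, w₀ + (0 : ℝ) • w) : Q × F) = (q, w₀) := by simp
    have h7 := (HasMFDerivAt.comp 0 (g := fun x : Q × F => K (e.toOpenPartialHomeomorph.symm x))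
      (by rw [h6]; exact h2.hasMFDerivAt) h3)
    have h8 := (show HasFDerivAt (𝕜 := ℝ) (E := ℝ) (F := ℝ) _ _ 0 from
      h7.hasFDerivAt).hasDerivAt.deriv
    have h9 : (fun t : ℝ => K ⟨q, a + t • e.symmL ℝ q w⟩) =
        (fun x : Q × F => K (e.toOpenPartialHomeomorph.symm x)) ∘ (fun t : ℝ => (q, w₀ + t • w)) := by
      funext t
      simp only [Function.comp_apply]
      congr 1
      have : e ⟨q, a + t • e.symmL ℝ q w⟩ = (q, w₀ + t • w) := by
        ext
        · exact e.coe_fst' hq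
        · have := (e.continuousLinearMapAt ℝ q).map_add a (t • e.symmL ℝ q w)
          rw [map_smul, Trivialization.continuousLinearMapAt_symmL _ hq] at this
          simpa [Trivialization.coe_linearMapAt_of_mem _ hq] using this
      rw [← this]
      exact (e.toOpenPartialHomeomorph.left_inv (by rw [e.mem_source]; exact hq)).symm
    rw [h9, h8]
    change _ = mvfderiv (𝓘(ℝ, B).prod 𝓘(ℝ, F))
      (fun x : Q × F => K (e.toOpenPartialHomeomorph.symm x)) (q, w₀) ((0 : B), (1 : ℝ) • w)
    rw [one_smul]
    rfl
end

section
variable [ContMDiffVectorBundle ∞ F E 𝓘(ℝ, B)]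

/-- If `K` has vanishing vertical derivative at `s(q)`, the derivative at `q` of `K` along a section
depends only on the value of the section at `q`. -/
theorem mvfderiv_comp_section_eq {K : TotalSpace F E → ℝ} {s s' : Sec B F E}
    {q : Q} (hs : s q = s' q)
    (hK : MDifferentiableAt (𝓘(ℝ, B).prod 𝓘(ℝ, F)) 𝓘(ℝ, ℝ) K ⟨q, s q⟩)
    (hv : ∀ b : E q, deriv (fun t : ℝ => K ⟨q, s q + t • b⟩) 0 = 0) (u : TangentSpace 𝓘(ℝ, B) q) :
    mvfderiv 𝓘(ℝ, B) (fun p => K ⟨p, s p⟩) q u = mvfderiv 𝓘(ℝ, B) (fun p => K ⟨p, s' p⟩) q u := by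
  obtain ⟨D, h1, h2⟩ := exists_mvfderiv_comp_section _ hK
  have key : ∀ v w, D (v, w) = D (v, 0) := by
    intro v w
    have : ((v, w) : B × F) = (v, 0) + (0, w) := by simp
    rw [this, map_add, h2, hv, add_zero]
  exact ((h1 s rfl u).trans (key _ _)).trans ((h1 s' hs.symm u).trans (key _ _)).symm
end
end
section
universe uB uQ uF uE
variable {B : Type uB} [NormedAddCommGroup B] [NormedSpace ℝ B]
  {Q : Type uQ} [TopologicalSpace Q] [ChartedSpace B Q]
  {F : Type uF} [NormedAddCommGroup F] [NormedSpace ℝ F]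
  {E : Q → Type uE} [∀ q, AddCommGroup (E q)] [∀ q, Module ℝ (E q)]
  [∀ q, TopologicalSpace (E q)] [TopologicalSpace (TotalSpace F E)]
  [FiberBundle F E] [VectorBundle ℝ F E]

theorem contMDiff_pairing [ContMDiffVectorBundle ∞ F E 𝓘(ℝ, B)]
    (s : Sec B (F →L[ℝ] ℝ) (DualFiber E)) (σ : Sec B F E) :
    ContMDiff 𝓘(ℝ, B) 𝓘(ℝ, ℝ) ∞ (fun q => s q (σ q)) := by
  have h := ContMDiff.clm_bundle_apply (E₂ := Trivial Q ℝ) (F₂ := ℝ) s.contMDiff σ.contMDiff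
  intro q
  exact (contMDiffAt_section q).1 (h q)

section dOne
variable [IsManifold 𝓘(ℝ, B) ∞ Q] [ContMDiffVectorBundle ∞ F E 𝓘(ℝ, B)]
  (A : SkewAlgebroid B F E) (s : Sec B (F →L[ℝ] ℝ) (DualFiber E))

theorem SkewAlgebroid.dOne_skew (σ γ : Sec B F E) (q : Q) :
    A.dOne s σ γ q = - A.dOne s γ σ q := by
  simp only [SkewAlgebroid.dOne]
  rw [A.bracket_skew σ γ, ContMDiffSection.coe_neg, Pi.neg_apply, map_neg]
  ring

theorem SkewAlgebroid.dOne_add (σ γ γ' : Sec B F E) (q : Q) :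
    A.dOne s σ (γ + γ') q = A.dOne s σ γ q + A.dOne s σ γ' q := by
  have h := fun γ : Sec B F E => (contMDiff_pairing s γ).mdifferentiable (by simp) q
  have h2 : (fun p => s p ((γ + γ') p)) = (fun p => s p (γ p)) + fun p => s p (γ' p) := by
    ext p; simp
  simp only [SkewAlgebroid.dOne, h2]
  rw [mvfderiv_add (h γ) (h γ')]
  simp
  ring

theorem SkewAlgebroid.dOne_fmul (f : C^∞⟮𝓘(ℝ, B), Q; ℝ⟯) (σ γ : Sec B F E) (q : Q) :
    A.dOne s σ (Sec.fmul f γ) q = f q * A.dOne s σ γ q := by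
  have h := (contMDiff_pairing s γ).mdifferentiable (by simp) q
  have h2 : (fun p => s p (Sec.fmul f γ p)) = ⇑f * fun p => s p (γ p) := by
    ext p; simp
  simp only [SkewAlgebroid.dOne, h2, A.leibniz]
  rw [mvfderiv_mul (f.contMDiff.mdifferentiable (by simp) q) h]
  simp
  ring
end dOne

section indep
variable [ContMDiffVectorBundle ∞ F E 𝓘(ℝ, B)]

/-- The fibrewise linear function on the dual bundle defined by a section. -/
def hat (σ : Sec B F E) (α : DualBundle F E) : ℝ := α.2 (σ α.1)

theorem contMDiff_hat (σ : Sec B F E) :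
    ContMDiff (𝓘(ℝ, B).prod 𝓘(ℝ, F →L[ℝ] ℝ)) 𝓘(ℝ, ℝ) ∞ (hat σ : DualBundle F E → ℝ) := by
  have h := ContMDiff.clm_bundle_apply (IM := 𝓘(ℝ, B).prod 𝓘(ℝ, F →L[ℝ] ℝ)) (IB := 𝓘(ℝ, B))
    (n := ∞) (E₁ := E) (E₂ := Trivial Q ℝ) (F₁ := F) (F₂ := ℝ)
    (b := fun α : DualBundle F E => α.1) (ϕ := fun α => α.2) (v := fun α => σ α.1)
    contMDiff_id (σ.contMDiff.comp (contMDiff_proj _))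
  intro α
  exact (contMDiffAt_totalSpace.1 (h α)).2

variable (B) in
theorem differentiableAt_fiber_line {G : DualBundle F E → ℝ} {α : DualBundle F E}
    (hG : MDifferentiableAt (𝓘(ℝ, B).prod 𝓘(ℝ, F →L[ℝ] ℝ)) 𝓘(ℝ, ℝ) G α) (β : DualFiber E α.1) :
    DifferentiableAt ℝ (fun t : ℝ => G ⟨α.1, α.2 + t • β⟩) 0 := by
  rw [← mdifferentiableAt_iff_differentiableAt]
  refine MDifferentiableAt.comp (I' := 𝓘(ℝ, B).prod 𝓘(ℝ, F →L[ℝ] ℝ)) (g := G) _ ?_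
    ((contMDiff_fiber_line (F := F →L[ℝ] ℝ) B α.1 α.2 β).mdifferentiable (by simp) _)
  simpa using hG

theorem hasDerivAt_hat (σ : Sec B F E) (α : DualBundle F E) (β : DualFiber E α.1) :
    HasDerivAt (fun t : ℝ => hat σ ⟨α.1, α.2 + t • β⟩) (β (σ α.1)) 0 := by
  have : (fun t : ℝ => hat σ (⟨α.1, α.2 + t • β⟩ : DualBundle F E)) =
      fun t => α.2 (σ α.1) + t * β (σ α.1) := by
    funext t; simp [hat]
  rw [this]
  simpa using ((hasDerivAt_id (0 : ℝ)).mul_const (β (σ α.1))).const_add (α.2 (σ α.1))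

theorem mvfderiv_comp_sub_hat [FiniteDimensional ℝ F] {G : DualBundle F E → ℝ}
    {s s' : Sec B (F →L[ℝ] ℝ) (DualFiber E)} {q : Q} (hs : s q = s' q)
    (hG : ContMDiff (𝓘(ℝ, B).prod 𝓘(ℝ, F →L[ℝ] ℝ)) 𝓘(ℝ, ℝ) ∞ G) (σ : Sec B F E)
    (hσ : σ q = fiberDeriv G ⟨q, s q⟩) (u : TangentSpace 𝓘(ℝ, B) q) :
    mvfderiv 𝓘(ℝ, B) (fun p => G ⟨p, s p⟩) q u - mvfderiv 𝓘(ℝ, B) (fun p => s p (σ p)) q u =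
    mvfderiv 𝓘(ℝ, B) (fun p => G ⟨p, s' p⟩) q u - mvfderiv 𝓘(ℝ, B) (fun p => s' p (σ p)) q u := by
  have hGm := hG.mdifferentiable (n := ∞) (by simp)
  have key : ∀ s : Sec B (F →L[ℝ] ℝ) (DualFiber E),
      mvfderiv 𝓘(ℝ, B) (fun p => G ⟨p, s p⟩) q u - mvfderiv 𝓘(ℝ, B) (fun p => s p (σ p)) q u =
      mvfderiv 𝓘(ℝ, B) (fun p => (G - hat σ) ⟨p, s p⟩) q u := by
    intro s
    have h1 : MDifferentiableAt 𝓘(ℝ, B) 𝓘(ℝ, ℝ) (fun p => G ⟨p, s p⟩) q :=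
      (hG.comp s.contMDiff).mdifferentiable (by simp) q
    have h2 := (contMDiff_pairing s σ).mdifferentiable (by simp) q
    have h3 := mvfderiv_sub h1 h2
    rw [← sub_apply, ← h3]
    rfl
  rw [key, key]
  refine mvfderiv_comp_section_eq hs
    (((hG.sub (contMDiff_hat σ)).mdifferentiable (n := ∞) (by simp)) _) (fun β => ?_) u
  have h1 := differentiableAt_fiber_line B (hGm ⟨q, s q⟩) β
  have h2 := hasDerivAt_hat σ ⟨q, s q⟩ β
  have h3 : HasDerivAt (fun t : ℝ => (G - hat σ) (⟨q, s q + t • β⟩ : DualBundle F E)) _ 0 :=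
    h1.hasDerivAt.sub h2
  refine h3.deriv.trans ?_
  have h4 := apply_fiberDeriv (hGm ⟨q, s q⟩) β
  rw [← hσ] at h4
  simp only [vertDeriv] at h4
  simp only [h4, sub_self]

variable [IsManifold 𝓘(ℝ, B) ∞ Q] [FiniteDimensional ℝ B] [T2Space Q]

theorem SkewAlgebroid.poissonAlong_congr [FiniteDimensional ℝ F] (A : SkewAlgebroid B F E)
    {G H : DualBundle F E → ℝ} {s s' : Sec B (F →L[ℝ] ℝ) (DualFiber E)} {q : Q}
    (hG : ContMDiff (𝓘(ℝ, B).prod 𝓘(ℝ, F →L[ℝ] ℝ)) 𝓘(ℝ, ℝ) ∞ G)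
    (hH : ContMDiff (𝓘(ℝ, B).prod 𝓘(ℝ, F →L[ℝ] ℝ)) 𝓘(ℝ, ℝ) ∞ H) (hs : s q = s' q) :
    A.poissonAlong s G H q = A.poissonAlong s' G H q := by
  have h1 := fun u => mvfderiv_comp_sub_hat hs hG
    (through B F q (fiberDeriv G ⟨q, s q⟩)) (through_self _ _) u
  have h2 := fun u => mvfderiv_comp_sub_hat hs hH
    (through B F q (fiberDeriv H ⟨q, s q⟩)) (through_self _ _) u
  simp only [SkewAlgebroid.poissonAlong, SkewAlgebroid.dOne, through_self]
  rw [← hs]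
  linear_combination h1 (A.anchor q (fiberDeriv H ⟨q, s q⟩))
    - h2 (A.anchor q (fiberDeriv G ⟨q, s q⟩))

theorem SkewAlgebroid.poisson_eq [FiniteDimensional ℝ F] (A : SkewAlgebroid B F E)
    {G H : DualBundle F E → ℝ} (s : Sec B (F →L[ℝ] ℝ) (DualFiber E)) (q : Q)
    (hG : ContMDiff (𝓘(ℝ, B).prod 𝓘(ℝ, F →L[ℝ] ℝ)) 𝓘(ℝ, ℝ) ∞ G)
    (hH : ContMDiff (𝓘(ℝ, B).prod 𝓘(ℝ, F →L[ℝ] ℝ)) 𝓘(ℝ, ℝ) ∞ H) :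
    A.poisson G H ⟨q, s q⟩ = A.poissonAlong s G H q :=
  A.poissonAlong_congr hG hH (through_self _ _)

end indep
end
section
universe uB uQ uF uE
variable {B : Type uB} [NormedAddCommGroup B] [NormedSpace ℝ B]
  {Q : Type uQ} [TopologicalSpace Q] [ChartedSpace B Q]
  {F : Type uF} [NormedAddCommGroup F] [NormedSpace ℝ F] [FiniteDimensional ℝ F]
  {E : Q → Type uE} [∀ q, AddCommGroup (E q)] [∀ q, Module ℝ (E q)]
  [∀ q, TopologicalSpace (E q)] [TopologicalSpace (TotalSpace F E)]
  [FiberBundle F E] [VectorBundle ℝ F E] [ContMDiffVectorBundle ∞ F E 𝓘(ℝ, B)]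

theorem kerLift_symmL {φ : NonvanishingCovector B F E} {q₀ q : Q} (hq : q ∈ kerBase φ q₀)
    (k : KerModel F) :
    KerFiber.incl φ q ((trivializationAt (KerModel F) (KerFiber φ) q₀).symmL ℝ q k) =
      (trivializationAt F E q₀).symmL ℝ q (kerLift φ q₀ q k) := by
  have hq' : q ∈ (trivializationAt (KerModel F) (KerFiber φ) q₀).baseSet := hq
  have h1 : kerPretriv φ q₀ ⟨q, (trivializationAt (KerModel F) (KerFiber φ) q₀).symmL ℝ q k⟩ =
      (q, k) := by
    rw [← ker_trivializationAt_apply, Trivialization.symmL_apply _ hq',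
      Trivialization.apply_mk_symm _ hq']
  have h2 := kerLift_kerPretriv φ hq
    ((trivializationAt (KerModel F) (KerFiber φ) q₀).symmL ℝ q k)
  rw [h1] at h2
  rw [h2, Trivialization.symmL_continuousLinearMapAt _ hq.1]

theorem contMDiff_mu (φ : NonvanishingCovector B F E) :
    ContMDiff (𝓘(ℝ, B).prod 𝓘(ℝ, F →L[ℝ] ℝ)) (𝓘(ℝ, B).prod 𝓘(ℝ, KerModel F →L[ℝ] ℝ)) ∞
      (mu φ) := by
  intro α₀
  have hp : ContMDiffAt (𝓘(ℝ, B).prod 𝓘(ℝ, F →L[ℝ] ℝ)) 𝓘(ℝ, B) ∞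
    (fun α : DualBundle F E => α.1) α₀ := contMDiffAt_proj _
  have hmem := (isOpen_kerBase φ α₀.1).mem_nhds (mem_kerBase_self φ α₀.1)
  rw [contMDiffAt_hom_bundle]
  refine ⟨hp, ?_⟩
  have h1 := ((contMDiffAt_hom_bundle (IM := 𝓘(ℝ, B).prod 𝓘(ℝ, F →L[ℝ] ℝ)) (IB := 𝓘(ℝ, B)) (n := ∞)
    (fun α : DualBundle F E => α) (x₀ := α₀)).1 contMDiffAt_id).2
  have h2 : ContMDiffAt (𝓘(ℝ, B).prod 𝓘(ℝ, F →L[ℝ] ℝ)) 𝓘(ℝ, KerModel F →L[ℝ] F) ∞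
      (fun α : DualBundle F E => kerLift φ α₀.1 α.1) α₀ :=
    ((contMDiffOn_kerLift φ α₀.1).contMDiffAt hmem).comp α₀ hp
  refine (h1.clm_comp h2).congr_of_eventuallyEq ?_
  filter_upwards [hp.continuousAt.eventually_mem hmem] with α hα
  ext k
  have := kerLift_symmL (φ := φ) (q₀ := α₀.1) hα k
  simp only [mu, muFiber, ContinuousLinearMap.inCoordinates, ContinuousLinearMap.comp_apply]
  rw [this]

variable [IsManifold 𝓘(ℝ, B) ∞ Q]

variable (B F E) in
/-- A Hamiltonian system on `E`: a skew-symmetric algebroid structure, a nowhere vanishing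
`1`-cocycle `φ`, and a smooth section `h : V^* → E^*` of `μ : E^* → V^*`. As `μ` covers the
identity of `Q`, so does `h`, which is therefore given by its restrictions `V_q^* → E_q^*`
(arbitrary maps, not assumed linear). -/
structure HamiltonianSystem extends SkewAlgebroid B F E where
  phi : NonvanishingCovector B F E
  isCocycle : toSkewAlgebroid.IsCocycle phi.toSec
  h : ∀ q, DualFiber (KerFiber phi) q → DualFiber E q
  contMDiff_h : ContMDiff (𝓘(ℝ, B).prod 𝓘(ℝ, KerModel F →L[ℝ] ℝ))
    (𝓘(ℝ, B).prod 𝓘(ℝ, F →L[ℝ] ℝ)) ∞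
    (fun v : DualBundle (KerModel F) (KerFiber phi) => (⟨v.1, h v.1 v.2⟩ : DualBundle F E))
  mu_h : ∀ (v : DualBundle (KerModel F) (KerFiber phi)), mu phi ⟨v.1, h v.1 v.2⟩ = v

namespace HamiltonianSystem
variable (S : HamiltonianSystem B F E)

/-- The vector bundle `V = ker φ`. -/
abbrev V (q : Q) : Type uE := KerFiber S.phi q

/-- The total space of `V^*`. -/
abbrev VDual : Type (max uQ uE) := DualBundle (KerModel F) S.V

/-- The map `μ : E^* → V^*`. -/
abbrev mu : DualBundle F E → S.VDual := HamiltonJacobi.mu S.phi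

/-- The section `h` as a map `V^* → E^*`. -/
def hMap (v : S.VDual) : DualBundle F E := ⟨v.1, S.h v.1 v.2⟩

theorem mu_h_fiber (q : Q) (v : DualFiber S.V q) : muFiber S.phi (S.h q v) = v := by
  have := S.mu_h ⟨q, v⟩
  simpa [HamiltonJacobi.mu] using this

theorem exists_energy (α : DualBundle F E) :
    ∃ c : ℝ, α.2 - S.h α.1 (muFiber S.phi α.2) = c • S.phi.toSec α.1 := by
  obtain ⟨e, he⟩ := S.phi.exists_eq_one α.1
  have h1 : (α.2 - S.h α.1 (muFiber S.phi α.2)).comp (KerFiber.incl S.phi α.1) = 0 := by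
    rw [ContinuousLinearMap.sub_comp]
    exact sub_eq_zero.2 (S.mu_h_fiber α.1 _).symm
  have h2 := S.phi.smul_eq h1 e
  rw [he, one_smul] at h2
  exact ⟨_, h2⟩

/-- The function `F_h : E^* → ℝ`, characterized by `α - h(μ(α)) = F_h(α) φ(q)` for `α ∈ E_q^*`. -/
def energy (α : DualBundle F E) : ℝ := (S.exists_energy α).choose

theorem energy_spec (α : DualBundle F E) :
    α.2 - S.h α.1 (muFiber S.phi α.2) = S.energy α • S.phi.toSec α.1 := (S.exists_energy α).choose_spec

theorem energy_add (α : DualBundle F E) (c : ℝ) :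
    S.energy ⟨α.1, α.2 + c • S.phi.toSec α.1⟩ = S.energy α + c := by
  obtain ⟨e, he⟩ := S.phi.exists_eq_one α.1
  have h1 := S.energy_spec α
  have h2 := S.energy_spec ⟨α.1, α.2 + c • S.phi.toSec α.1⟩
  have h3 : muFiber S.phi (α.2 + c • S.phi.toSec α.1) = muFiber S.phi α.2 := by
    ext x
    simp [muFiber]
  dsimp only at h2
  rw [h3] at h2
  have h4 := congrArg (fun l => l e) h1
  have h5 := congrArg (fun l => l e) h2
  simp [he] at h4 h5
  linarith

variable [FiniteDimensional ℝ B] [T2Space Q]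

/-- The function `F_h` is smooth. -/
theorem contMDiff_energy :
    ContMDiff (𝓘(ℝ, B).prod 𝓘(ℝ, F →L[ℝ] ℝ)) 𝓘(ℝ, ℝ) ∞ S.energy := by
  intro α₀
  obtain ⟨e, he⟩ := S.phi.exists_eq_one α₀.1
  set σ := through B F α₀.1 e with hσ
  have hp : ContMDiff (𝓘(ℝ, B).prod 𝓘(ℝ, F →L[ℝ] ℝ)) 𝓘(ℝ, B) ∞
    (fun α : DualBundle F E => α.1) := contMDiff_proj _
  have h1 : ContMDiff (𝓘(ℝ, B).prod 𝓘(ℝ, F →L[ℝ] ℝ)) 𝓘(ℝ, ℝ) ∞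
      (fun α : DualBundle F E => S.phi.toSec α.1 (σ α.1)) :=
    (contMDiff_pairing S.phi.toSec σ).comp hp
  have h2 : ContMDiff (𝓘(ℝ, B).prod 𝓘(ℝ, F →L[ℝ] ℝ)) 𝓘(ℝ, ℝ) ∞
      (fun α : DualBundle F E => hat σ α - hat σ (S.hMap (S.mu α))) :=
    (contMDiff_hat σ).sub ((contMDiff_hat σ).comp (S.contMDiff_h.comp (contMDiff_mu S.phi)))
  have hne : S.phi.toSec α₀.1 (σ α₀.1) ≠ 0 := by
    rw [hσ, through_self, he]; exact one_ne_zero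
  refine ((h2 α₀).div₀ (h1 α₀) hne).congr_of_eventuallyEq ?_
  filter_upwards [(h1 α₀).continuousAt.eventually_ne hne] with α hα
  have h4 := congrArg (fun l => l (σ α.1)) (S.energy_spec α)
  simp only [sub_apply, smul_apply, smul_eq_mul] at h4
  rw [Pi.div_apply, eq_div_iff hα, ← h4]
  rfl

theorem mu_shift {q : Q} (a : DualFiber E q) (c : ℝ) :
    S.mu ⟨q, a + c • S.phi.toSec q⟩ = S.mu ⟨q, a⟩ := by
  simp only [HamiltonJacobi.mu]
  congr 1
  ext x
  simp [muFiber]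

/-- The function `{G ∘ μ, F_h}` is constant along the fibres of `μ`. -/
theorem poisson_shift {G : S.VDual → ℝ}
    (hG : ContMDiff (𝓘(ℝ, B).prod 𝓘(ℝ, KerModel F →L[ℝ] ℝ)) 𝓘(ℝ, ℝ) ∞ G) {q : Q}
    (a : DualFiber E q) (c : ℝ) :
    S.poisson (G ∘ S.mu) S.energy ⟨q, a + c • S.phi.toSec q⟩ =
      S.poisson (G ∘ S.mu) S.energy ⟨q, a⟩ := by
  have hG' := hG.comp (contMDiff_mu S.phi)
  set s : Sec B (F →L[ℝ] ℝ) (DualFiber E) := through B (F →L[ℝ] ℝ) q a with hs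
  have hsq : s q = a := through_self q a
  set s' : Sec B (F →L[ℝ] ℝ) (DualFiber E) := s + c • S.phi.toSec with hs'
  have hsq' : ∀ p, s' p = s p + c • S.phi.toSec p := fun p => by simp [hs']
  have hdOne : ∀ σ γ, S.dOne s' σ γ q = S.dOne s σ γ q := by
    intro σ γ
    have h0 := S.isCocycle σ γ q
    have key : ∀ τ : Sec B F E, mvfderiv 𝓘(ℝ, B) (fun p => s' p (τ p)) q =
        mvfderiv 𝓘(ℝ, B) (fun p => s p (τ p)) q +
          c • mvfderiv 𝓘(ℝ, B) (fun p => S.phi.toSec p (τ p)) q := by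
      intro τ
      have h1 := (contMDiff_pairing s τ).mdifferentiable (by simp) q
      have h2 := (contMDiff_pairing S.phi.toSec τ).mdifferentiable (by simp) q
      have h3 : MDifferentiableAt 𝓘(ℝ, B) 𝓘(ℝ, ℝ) (fun _ : Q => c) q := mdifferentiableAt_const
      have h4 : (fun p => s' p (τ p)) = (fun p => s p (τ p)) +
          (fun _ : Q => c) * (fun p => S.phi.toSec p (τ p)) := by
        ext p; simp [hsq']
      rw [h4, mvfderiv_add h1 (h3.mul h2), mvfderiv_mul h3 h2, mvfderiv_const]
      simp
    simp only [SkewAlgebroid.dOne] at h0 ⊢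
    rw [key, key]
    simp only [hsq', add_apply, smul_apply, smul_eq_mul]
    linear_combination c * h0
  have h1 : S.poisson (G ∘ S.mu) S.energy ⟨q, s' q⟩ = S.poisson (G ∘ S.mu) S.energy ⟨q, s q⟩ := by
    rw [S.poisson_eq s' q hG' S.contMDiff_energy, S.poisson_eq s q hG' S.contMDiff_energy]
    have hx : fiberDeriv (G ∘ S.mu) ⟨q, s' q⟩ = fiberDeriv (G ∘ S.mu) ⟨q, s q⟩ := by
      refine fiberDeriv_congr fun β => ?_
      simp only [vertDeriv, Function.comp_apply, hsq']
      congr 1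
      funext t
      rw [add_right_comm, S.mu_shift]
    have hE : ∀ p (b : DualFiber E p), S.energy ⟨p, b + c • S.phi.toSec p⟩ = S.energy ⟨p, b⟩ + c :=
      fun p b => S.energy_add ⟨p, b⟩ c
    have hy : fiberDeriv S.energy ⟨q, s' q⟩ = fiberDeriv S.energy ⟨q, s q⟩ := by
      refine fiberDeriv_congr fun β => ?_
      simp only [vertDeriv, hsq']
      simp_rw [add_right_comm _ (c • _), hE]
      simp
    have h3 : (fun p => (G ∘ S.mu) ⟨p, s' p⟩) = fun p => (G ∘ S.mu) ⟨p, s p⟩ := by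
      funext p
      simp only [Function.comp_apply, hsq', S.mu_shift]
    have h4 : mvfderiv 𝓘(ℝ, B) (fun p => S.energy ⟨p, s' p⟩) q =
        mvfderiv 𝓘(ℝ, B) (fun p => S.energy ⟨p, s p⟩) q := by
      have h5 : (fun p => S.energy ⟨p, s' p⟩) = (fun p => S.energy ⟨p, s p⟩) + fun _ => c := by
        funext p
        simp only [hsq', hE, Pi.add_apply]
      have h6 : MDifferentiableAt 𝓘(ℝ, B) 𝓘(ℝ, ℝ) (fun p => S.energy ⟨p, s p⟩) q :=
        (S.contMDiff_energy.comp s.contMDiff).mdifferentiable (by simp) q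
      rw [h5, mvfderiv_add h6
        mdifferentiableAt_const, mvfderiv_const, add_zero]
    simp only [SkewAlgebroid.poissonAlong, hdOne, hx, hy, h3, h4]
  rw [hsq', hsq] at h1
  exact h1

theorem exists_hamiltonianVector_aux (s : Sec B (F →L[ℝ] ℝ) (DualFiber E)) (q : Q) :
    ∃ X : TangentSpace (𝓘(ℝ, B).prod 𝓘(ℝ, KerModel F →L[ℝ] ℝ)) (S.mu ⟨q, s q⟩),
      ∀ G : S.VDual → ℝ, ContMDiff (𝓘(ℝ, B).prod 𝓘(ℝ, KerModel F →L[ℝ] ℝ)) 𝓘(ℝ, ℝ) ∞ G →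
          mvfderiv (𝓘(ℝ, B).prod 𝓘(ℝ, KerModel F →L[ℝ] ℝ)) G (S.mu ⟨q, s q⟩) X =
            S.poisson (G ∘ S.mu) S.energy ⟨q, s q⟩ := by
  set y := fiberDeriv S.energy ⟨q, s q⟩ with hy
  have : T2Space (S.V q) := FiberBundle.t2Space (KerModel F) S.V q
  have : FiniteDimensional ℝ (S.V q) := VectorBundle.finiteDimensional ℝ (KerModel F) S.V q
  have : IsTopologicalAddGroup (S.V q) :=
    (VectorBundle.continuousLinearEquivAt ℝ (KerModel F) S.V
      q).toContinuousAddEquiv.isTopologicalAddGroup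
  have : ContinuousSMul ℝ (S.V q) :=
    (VectorBundle.continuousLinearEquivAt ℝ (KerModel F) S.V q).continuousSMul
  have hdsmul : ∀ (c : ℝ) (σ γ : Sec B F E), S.dOne s σ (c • γ) q = c * S.dOne s σ γ q := by
    intro c σ γ
    have h := S.dOne_fmul s ⟨fun _ => c, contMDiff_const⟩ σ γ q
    have h2 : Sec.fmul ⟨fun _ => c, contMDiff_const⟩ γ = c • γ := by ext p; rfl
    rw [h2] at h
    exact h
  let lam : DualFiber S.V q := LinearMap.toContinuousLinearMap
    { toFun := fun z => S.dOne s (through B F q (KerFiber.incl S.phi q z)) (through B F q y) q -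
        mvfderiv 𝓘(ℝ, B) (fun p => S.energy ⟨p, s p⟩) q (S.anchor q (KerFiber.incl S.phi q z))
      map_add' := fun z z' => by
        rw [S.dOne_skew, S.dOne_skew s (through B F q (KerFiber.incl S.phi q z)),
          S.dOne_skew s (through B F q (KerFiber.incl S.phi q z')), map_add, map_add, S.dOne_add,
          map_add, map_add]
        ring
      map_smul' := fun c z => by
        rw [S.dOne_skew, S.dOne_skew s (through B F q (KerFiber.incl S.phi q z)),
          map_smul, map_smul, hdsmul, map_smul, map_smul, RingHom.id_apply]
        simp only [smul_eq_mul]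
        ring }
  have hlam : ∀ z, lam z = S.dOne s (through B F q (KerFiber.incl S.phi q z)) (through B F q y) q -
        mvfderiv 𝓘(ℝ, B) (fun p => S.energy ⟨p, s p⟩) q (S.anchor q (KerFiber.incl S.phi q z)) :=
    fun z => rfl
  have ht : ContMDiff 𝓘(ℝ, B) (𝓘(ℝ, B).prod 𝓘(ℝ, KerModel F →L[ℝ] ℝ)) ∞
      (fun p => S.mu ⟨p, s p⟩) := (contMDiff_mu S.phi).comp s.contMDiff
  have hl := contMDiff_fiber_line (E := DualFiber S.V) (F := KerModel F →L[ℝ] ℝ) B q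
    (muFiber S.phi (s q)) lam
  let X₁ : TangentSpace (𝓘(ℝ, B).prod 𝓘(ℝ, KerModel F →L[ℝ] ℝ)) (S.mu ⟨q, s q⟩) :=
    mfderiv 𝓘(ℝ, B) (𝓘(ℝ, B).prod 𝓘(ℝ, KerModel F →L[ℝ] ℝ)) (fun p => S.mu ⟨p, s p⟩) q
      (S.anchor q y)
  let X₂ : TangentSpace (𝓘(ℝ, B).prod 𝓘(ℝ, KerModel F →L[ℝ] ℝ)) (S.mu ⟨q, s q⟩) :=
    mfderiv 𝓘(ℝ, ℝ) (𝓘(ℝ, B).prod 𝓘(ℝ, KerModel F →L[ℝ] ℝ))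
        (fun t : ℝ => (⟨q, muFiber S.phi (s q) + t • lam⟩ : S.VDual)) 0 (1 : ℝ)
  refine ⟨X₁ + X₂, ?_⟩
  intro G hG
  have hG' := hG.comp (contMDiff_mu S.phi)
  have hGd := hG.mdifferentiable (by simp) (S.mu ⟨q, s q⟩)
  rw [S.poisson_eq s q hG' S.contMDiff_energy]
  have h1 := mvfderiv_comp_apply (g := G) (f := fun p => S.mu ⟨p, s p⟩) q hGd
    (ht.mdifferentiable (by simp) q) (S.anchor q y)
  have h2 := mvfderiv_comp_apply_of_eq (g := G) (y := S.mu ⟨q, s q⟩)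
    (f := fun t : ℝ => (⟨q, muFiber S.phi (s q) + t • lam⟩ : S.VDual)) (0 : ℝ) hGd
    (hl.mdifferentiable (by simp) 0) (by simp [HamiltonJacobi.mu]) (1 : ℝ)
  let z : S.V q := fiberDeriv G (S.mu ⟨q, s q⟩)
  have h3 : lam z = vertDeriv G (S.mu ⟨q, s q⟩) lam := apply_fiberDeriv hGd lam
  have h4 : fiberDeriv (G ∘ S.mu) ⟨q, s q⟩ = KerFiber.incl S.phi q z := by
    refine eq_of_forall_dual (fun β => ?_) F
    rw [apply_fiberDeriv (hG'.mdifferentiable (by simp) _) β]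
    have h5 := apply_fiberDeriv hGd (muFiber S.phi β)
    refine Eq.trans ?_ h5.symm
    simp only [vertDeriv, Function.comp_apply]
    rfl
  have h6 : mvfderiv (𝓘(ℝ, B).prod 𝓘(ℝ, KerModel F →L[ℝ] ℝ)) G (S.mu ⟨q, s q⟩) X₂ = lam z := by
    refine Eq.trans h2.symm (Eq.trans ?_ h3.symm)
    change mfderiv 𝓘(ℝ, ℝ) 𝓘(ℝ, ℝ)
      (fun t : ℝ => G (⟨q, muFiber S.phi (s q) + t • lam⟩ : S.VDual)) 0 (1 : ℝ) =
      deriv (fun t : ℝ => G (⟨q, muFiber S.phi (s q) + t • lam⟩ : S.VDual)) 0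
    rw [mfderiv_eq_fderiv]
    exact fderiv_apply_one_eq_deriv
  have h7 : mvfderiv (𝓘(ℝ, B).prod 𝓘(ℝ, KerModel F →L[ℝ] ℝ)) G (S.mu ⟨q, s q⟩) X₁ =
      mvfderiv 𝓘(ℝ, B) (fun p => (G ∘ S.mu) ⟨p, s p⟩) q (S.anchor q y) := h1.symm
  have h8 : ∀ X X' : TangentSpace (𝓘(ℝ, B).prod 𝓘(ℝ, KerModel F →L[ℝ] ℝ)) (S.mu ⟨q, s q⟩),
      mvfderiv (𝓘(ℝ, B).prod 𝓘(ℝ, KerModel F →L[ℝ] ℝ)) G (S.mu ⟨q, s q⟩) (X + X') =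
      mvfderiv (𝓘(ℝ, B).prod 𝓘(ℝ, KerModel F →L[ℝ] ℝ)) G (S.mu ⟨q, s q⟩) X +
      mvfderiv (𝓘(ℝ, B).prod 𝓘(ℝ, KerModel F →L[ℝ] ℝ)) G (S.mu ⟨q, s q⟩) X' :=
    fun X X' => (mvfderiv (𝓘(ℝ, B).prod 𝓘(ℝ, KerModel F →L[ℝ] ℝ)) G (S.mu ⟨q, s q⟩)).map_add X X'
  refine (h8 X₁ X₂).trans ?_
  rw [h6, h7, hlam]
  simp only [SkewAlgebroid.poissonAlong, h4, ← hy]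
  ring

/-- Existence of the value at `v` of the Hamiltonian vector field. -/
theorem exists_hamiltonianVector (v : S.VDual) :
    ∃ X : TangentSpace (𝓘(ℝ, B).prod 𝓘(ℝ, KerModel F →L[ℝ] ℝ)) v,
      ∀ G : S.VDual → ℝ, ContMDiff (𝓘(ℝ, B).prod 𝓘(ℝ, KerModel F →L[ℝ] ℝ)) 𝓘(ℝ, ℝ) ∞ G →
        ∀ α : DualBundle F E, S.mu α = v →
          mvfderiv (𝓘(ℝ, B).prod 𝓘(ℝ, KerModel F →L[ℝ] ℝ)) G v X =
            S.poisson (G ∘ S.mu) S.energy α := by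
  have h1 := S.exists_hamiltonianVector_aux (through B (F →L[ℝ] ℝ) v.1 (S.h v.1 v.2)) v.1
  have h0 : S.mu ⟨v.1, S.h v.1 v.2⟩ = v := S.mu_h v
  rw [through_self, h0] at h1
  obtain ⟨X, hX⟩ := h1
  refine ⟨X, fun G hG α hα => ?_⟩
  rw [hX G hG]
  subst hα
  have h2 : α = ⟨α.1, S.h α.1 (muFiber S.phi α.2) + S.energy α • S.phi.toSec α.1⟩ := by
    rw [← S.energy_spec α]
    simp
  conv_rhs => rw [h2]
  rw [S.poisson_shift hG]
  rfl

end HamiltonianSystem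
end
section
universe uB uQ uF uE
variable {B : Type uB} [NormedAddCommGroup B] [NormedSpace ℝ B] [FiniteDimensional ℝ B]
  {Q : Type uQ} [TopologicalSpace Q] [ChartedSpace B Q] [IsManifold 𝓘(ℝ, B) ∞ Q] [T2Space Q]
  {F : Type uF} [NormedAddCommGroup F] [NormedSpace ℝ F] [FiniteDimensional ℝ F]
  {E : Q → Type uE} [∀ q, AddCommGroup (E q)] [∀ q, Module ℝ (E q)]
  [∀ q, TopologicalSpace (E q)] [TopologicalSpace (TotalSpace F E)]
  [FiberBundle F E] [VectorBundle ℝ F E] [ContMDiffVectorBundle ∞ F E 𝓘(ℝ, B)]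

/-- Near `q`, a section is a combination of fixed sections with smooth coefficients. -/
theorem exists_fmul_decomp (γ : Sec B F E) (q : Q) :
    ∃ (g : C^∞⟮𝓘(ℝ, B), Q; ℝ⟯) (c : Fin (finrank ℝ F) → C^∞⟮𝓘(ℝ, B), Q; ℝ⟯)
      (τ : Fin (finrank ℝ F) → Sec B F E), g q = 1 ∧ (γ q = 0 → ∀ i, c i q = 0) ∧
      Sec.fmul g γ = ∑ i, Sec.fmul (c i) (τ i) := by
  set e := trivializationAt F E q with he
  have hq : q ∈ e.baseSet := FiberBundle.mem_baseSet_trivializationAt' q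
  let b := finBasis ℝ F
  let β := bump B F E q
  have hβ : ContMDiff 𝓘(ℝ, B) 𝓘(ℝ, ℝ) ∞ β := β.contMDiff
  have hc : ∀ i, ContMDiff 𝓘(ℝ, B) 𝓘(ℝ, ℝ) ∞
      (fun p => β p * b.coord i (e.continuousLinearMapAt ℝ p (γ p))) := by
    intro i
    refine contMDiff_of_tsupport fun p hp => ?_
    have hp' : p ∈ e.baseSet := tsupport_bump q
      ((tsupport_mul_subset_left (f := β)
        (g := fun p => b.coord i (e.continuousLinearMapAt ℝ p (γ p)))) hp)
    have h1 : ContMDiffAt 𝓘(ℝ, B) 𝓘(ℝ, F) ∞ (fun p => e.continuousLinearMapAt ℝ p (γ p)) p := by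
      have h2 := (Bundle.Trivialization.contMDiffOn_section_baseSet_iff (IB := 𝓘(ℝ, B)) (n := ∞)
        e (s := γ)).1 γ.contMDiff.contMDiffOn
      refine (h2.contMDiffAt (e.open_baseSet.mem_nhds hp')).congr_of_eventuallyEq ?_
      filter_upwards [e.open_baseSet.mem_nhds hp'] with x hx
      rw [Trivialization.continuousLinearMapAt_apply, Trivialization.coe_linearMapAt_of_mem _ hx]
    have h3 : ContMDiffAt 𝓘(ℝ, B) 𝓘(ℝ, ℝ) ∞
        (fun p => (LinearMap.toContinuousLinearMap (b.coord i))
          (e.continuousLinearMapAt ℝ p (γ p))) p :=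
      ((LinearMap.toContinuousLinearMap (b.coord i)).contDiff.contMDiff _).comp p h1
    exact (hβ p).smul h3
  refine ⟨⟨fun p => β p * β p, hβ.smul hβ⟩, fun i => ⟨_, hc i⟩,
    fun i => through B F q (e.symmL ℝ q (b i)), ?_, ?_, ?_⟩
  · change β q * β q = 1
    rw [SmoothBumpFunction.eq_one, one_mul]
  · intro h0 i
    change β q * b.coord i (e.continuousLinearMapAt ℝ q (γ q)) = 0
    rw [h0, map_zero, map_zero, mul_zero]
  · ext p
    have hsum : (∑ i, Sec.fmul ⟨_, hc i⟩ (through B F q (e.symmL ℝ q (b i)))) p =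
        ∑ i, (β p * b.coord i (e.continuousLinearMapAt ℝ p (γ p))) •
          through B F q (e.symmL ℝ q (b i)) p := by
      have := map_sum (ContMDiffSection.coeAddHom 𝓘(ℝ, B) F ∞ E)
        (fun i => Sec.fmul ⟨_, hc i⟩ (through B F q (e.symmL ℝ q (b i)))) Finset.univ
      have h2 := congrFun this p
      rw [Finset.sum_apply] at h2
      exact h2
    rw [hsum]
    have hthr : ∀ i, through B F q (e.symmL ℝ q (b i)) p = β p • e.symmL ℝ p (b i) := by
      intro i
      change β p • e.symmL ℝ p (e.continuousLinearMapAt ℝ q (e.symmL ℝ q (b i))) = _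
      rw [Trivialization.continuousLinearMapAt_symmL _ hq]
    simp only [hthr]
    change (β p * β p) • γ p = _
    by_cases hp : p ∈ e.baseSet
    · have h4 : γ p = ∑ i, b.coord i (e.continuousLinearMapAt ℝ p (γ p)) • e.symmL ℝ p (b i) := by
        conv_lhs => rw [← Trivialization.symmL_continuousLinearMapAt (R := ℝ) e hp (γ p),
          ← b.sum_repr (e.continuousLinearMapAt ℝ p (γ p))]
        rw [map_sum]
        simp only [map_smul]
        rfl
      conv_lhs => rw [h4]
      rw [Finset.smul_sum]
      refine Finset.sum_congr rfl fun i _ => ?_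
      rw [smul_smul, smul_smul]
      congr 1
      ring
    · have hβ0 : β p = 0 := by
        by_contra h
        exact hp (tsupport_bump q (subset_tsupport _ h))
      simp [hβ0]

theorem fiberDeriv_eq {G : DualBundle F E → ℝ} {α : DualBundle F E} {x : E α.1}
    (h : ∀ β : DualFiber E α.1, vertDeriv G α β = β x) : fiberDeriv G α = x := by
  have hex : ∃ x : E α.1, ∀ β : DualFiber E α.1, β x = vertDeriv G α β := ⟨x, fun β => (h β).symm⟩
  refine eq_of_forall_dual (fun β => ?_) F
  rw [fiberDeriv, dif_pos hex, hex.choose_spec, h]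

namespace SkewAlgebroid
variable (A : SkewAlgebroid B F E)

theorem dOne_eq_zero_of_right (s : Sec B (F →L[ℝ] ℝ) (DualFiber E)) (σ γ : Sec B F E) (q : Q)
    (h : γ q = 0) : A.dOne s σ γ q = 0 := by
  obtain ⟨g, c, τ, hg, hc, hdec⟩ := exists_fmul_decomp γ q
  have h1 := A.dOne_fmul s g σ γ q
  rw [hg, one_mul, hdec] at h1
  rw [← h1]
  have hz : A.dOne s σ 0 q = 0 := by
    have := A.dOne_add s σ 0 0 q
    rw [add_zero] at this
    linarith
  have : ∀ t : Finset (Fin (finrank ℝ F)), A.dOne s σ (∑ i ∈ t, Sec.fmul (c i) (τ i)) q = 0 := by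
    intro t
    induction t using Finset.induction_on with
    | empty => simpa using hz
    | insert i t hi ih =>
      rw [Finset.sum_insert hi, A.dOne_add, ih, A.dOne_fmul, hc h i]
      simp
  exact this _

theorem dOne_congr (s : Sec B (F →L[ℝ] ℝ) (DualFiber E)) {σ σ' γ γ' : Sec B F E} {q : Q}
    (hσ : σ q = σ' q) (hγ : γ q = γ' q) : A.dOne s σ γ q = A.dOne s σ' γ' q := by
  have key : ∀ (σ γ γ' : Sec B F E), γ q = γ' q → A.dOne s σ γ q = A.dOne s σ γ' q := by
    intro σ γ γ' h
    have h1 := A.dOne_add s σ γ' (γ - γ') q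
    rw [add_sub_cancel, A.dOne_eq_zero_of_right s σ (γ - γ') q (by simp [h]), add_zero] at h1
    exact h1
  rw [key σ γ γ' hγ, A.dOne_skew, key γ' σ σ' hσ, ← A.dOne_skew]

theorem fiberDeriv_hat (σ : Sec B F E) (α : DualBundle F E) : fiberDeriv (hat σ) α = σ α.1 :=
  HamiltonJacobi.fiberDeriv_eq fun β => (hasDerivAt_hat σ α β).deriv

theorem fiberDeriv_base (f : Q → ℝ) (α : DualBundle F E) :
    fiberDeriv (fun α : DualBundle F E => f α.1) α = 0 :=
  HamiltonJacobi.fiberDeriv_eq fun β => by simp [vertDeriv]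

/-- `{σ^, γ^} = -⟦σ, γ⟧^`. -/
theorem poisson_hat_hat (σ γ : Sec B F E) (α : DualBundle F E) :
    A.poisson (hat σ) (hat γ) α = - hat (A.bracket σ γ) α := by
  have h0 : (through B (F →L[ℝ] ℝ) α.1 α.2 : Sec B (F →L[ℝ] ℝ) (DualFiber E)) α.1 = α.2 :=
    through_self _ _
  simp only [poisson, poissonAlong, fiberDeriv_hat]
  rw [A.dOne_congr _ (through_self α.1 (σ α.1)) (through_self α.1 (γ α.1))]
  simp only [dOne, hat, h0]
  ring

/-- `{f ∘ τ, σ^} = ρ(σ)(f) ∘ τ`. -/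
theorem poisson_base_hat (f : C^∞⟮𝓘(ℝ, B), Q; ℝ⟯) (σ : Sec B F E) (α : DualBundle F E) :
    A.poisson (fun α => f α.1) (hat σ) α = mvfderiv 𝓘(ℝ, B) f α.1 (A.anchor α.1 (σ α.1)) := by
  simp only [poisson, poissonAlong, fiberDeriv_hat, fiberDeriv_base]
  rw [A.dOne_skew, A.dOne_eq_zero_of_right _ _ _ _ (through_self _ _)]
  simp

/-- `{f ∘ τ, g ∘ τ} = 0`. -/
theorem poisson_base_base (f g : C^∞⟮𝓘(ℝ, B), Q; ℝ⟯) (α : DualBundle F E) :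
    A.poisson (fun α => f α.1) (fun α => g α.1) α = 0 := by
  simp only [poisson, poissonAlong, fiberDeriv_base]
  rw [A.dOne_eq_zero_of_right _ _ _ _ (through_self _ _)]
  simp

/-- The bracket is skew-symmetric. -/
theorem poisson_skew (G H : DualBundle F E → ℝ) (α : DualBundle F E) :
    A.poisson G H α = - A.poisson H G α := by
  simp only [poisson, poissonAlong]
  rw [A.dOne_skew]
  ring

theorem fiberDeriv_add {G H : DualBundle F E → ℝ} {α : DualBundle F E}
    (hG : MDifferentiableAt (𝓘(ℝ, B).prod 𝓘(ℝ, F →L[ℝ] ℝ)) 𝓘(ℝ, ℝ) G α)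
    (hH : MDifferentiableAt (𝓘(ℝ, B).prod 𝓘(ℝ, F →L[ℝ] ℝ)) 𝓘(ℝ, ℝ) H α) :
    fiberDeriv (G + H) α = fiberDeriv G α + fiberDeriv H α := by
  refine HamiltonJacobi.fiberDeriv_eq fun β => ?_
  rw [map_add, apply_fiberDeriv hG, apply_fiberDeriv hH]
  exact deriv_add (differentiableAt_fiber_line B hG β) (differentiableAt_fiber_line B hH β)

theorem fiberDeriv_mul {G H : DualBundle F E → ℝ} {α : DualBundle F E}
    (hG : MDifferentiableAt (𝓘(ℝ, B).prod 𝓘(ℝ, F →L[ℝ] ℝ)) 𝓘(ℝ, ℝ) G α)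
    (hH : MDifferentiableAt (𝓘(ℝ, B).prod 𝓘(ℝ, F →L[ℝ] ℝ)) 𝓘(ℝ, ℝ) H α) :
    fiberDeriv (G * H) α = G α • fiberDeriv H α + H α • fiberDeriv G α := by
  refine HamiltonJacobi.fiberDeriv_eq fun β => ?_
  rw [map_add, map_smul, map_smul, apply_fiberDeriv hG, apply_fiberDeriv hH]
  have := deriv_mul (differentiableAt_fiber_line B hG β) (differentiableAt_fiber_line B hH β)
  refine this.trans ?_
  simp [vertDeriv]
  ring

theorem dOne_smul_right (s : Sec B (F →L[ℝ] ℝ) (DualFiber E)) (c : ℝ) (σ γ : Sec B F E) (q : Q) :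
    A.dOne s σ (c • γ) q = c * A.dOne s σ γ q :=
  A.dOne_fmul s ⟨fun _ => c, contMDiff_const⟩ σ γ q

/-- The bracket is additive in the second argument. -/
theorem poisson_add_right {G H K : DualBundle F E → ℝ}
    (hH : ContMDiff (𝓘(ℝ, B).prod 𝓘(ℝ, F →L[ℝ] ℝ)) 𝓘(ℝ, ℝ) ∞ H)
    (hK : ContMDiff (𝓘(ℝ, B).prod 𝓘(ℝ, F →L[ℝ] ℝ)) 𝓘(ℝ, ℝ) ∞ K) (α : DualBundle F E) :
    A.poisson G (H + K) α = A.poisson G H α + A.poisson G K α := by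
  set s : Sec B (F →L[ℝ] ℝ) (DualFiber E) := through B (F →L[ℝ] ℝ) α.1 α.2 with hs
  have h1 := mvfderiv_add (I := 𝓘(ℝ, B)) ((hH.comp s.contMDiff).mdifferentiable (by simp) α.1)
    ((hK.comp s.contMDiff).mdifferentiable (by simp) α.1)
  have h2 : (fun p => (H + K) ⟨p, s p⟩) =
    (H ∘ fun p => (⟨p, s p⟩ : DualBundle F E)) + K ∘ fun p => ⟨p, s p⟩ := rfl
  simp only [poisson, poissonAlong, ← hs]
  rw [fiberDeriv_add (hH.mdifferentiable (by simp) _) (hK.mdifferentiable (by simp) _), h2, h1]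
  simp only [map_add, dOne_add, add_apply]
  simp only [Function.comp_def]
  ring

/-- The bracket is a derivation in the second argument. -/
theorem poisson_mul_right {G H K : DualBundle F E → ℝ}
    (hH : ContMDiff (𝓘(ℝ, B).prod 𝓘(ℝ, F →L[ℝ] ℝ)) 𝓘(ℝ, ℝ) ∞ H)
    (hK : ContMDiff (𝓘(ℝ, B).prod 𝓘(ℝ, F →L[ℝ] ℝ)) 𝓘(ℝ, ℝ) ∞ K) (α : DualBundle F E) :
    A.poisson G (H * K) α = H α * A.poisson G K α + K α * A.poisson G H α := by
  set s : Sec B (F →L[ℝ] ℝ) (DualFiber E) := through B (F →L[ℝ] ℝ) α.1 α.2 with hs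
  have hsq : s α.1 = α.2 := through_self _ _
  have h1 := mvfderiv_mul (I := 𝓘(ℝ, B)) ((hH.comp s.contMDiff).mdifferentiable (by simp) α.1)
    ((hK.comp s.contMDiff).mdifferentiable (by simp) α.1)
  have h2 : (fun p => (H * K) ⟨p, s p⟩) =
    (H ∘ fun p => (⟨p, s p⟩ : DualBundle F E)) * K ∘ fun p => ⟨p, s p⟩ := rfl
  simp only [poisson, poissonAlong, ← hs]
  rw [fiberDeriv_mul (hH.mdifferentiable (by simp) _) (hK.mdifferentiable (by simp) _), h2, h1]
  simp only [map_add, map_smul, dOne_add, dOne_smul_right, add_apply, smul_apply, smul_eq_mul]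
  simp only [Function.comp_def, hsq, through_self]
  ring

end SkewAlgebroid
end
section
universe uB uQ uF uE

/-- Smooth functions separate tangent vectors. -/
theorem eq_of_forall_mvfderiv {M₀ H₀ M : Type*} [NormedAddCommGroup M₀] [NormedSpace ℝ M₀]
    [FiniteDimensional ℝ M₀] [TopologicalSpace H₀] {I : ModelWithCorners ℝ M₀ H₀}
    [TopologicalSpace M] [ChartedSpace H₀ M] [IsManifold I ∞ M] [T2Space M] {v : M}
    {X Y : TangentSpace I v}
    (h : ∀ G : M → ℝ, ContMDiff I 𝓘(ℝ, ℝ) ∞ G → mvfderiv I G v X = mvfderiv I G v Y) : X = Y := by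
  have : IsManifold I 1 M := IsManifold.of_le (n := ∞) (by simp)
  let f : SmoothBumpFunction I v := Classical.choice inferInstance
  have hinj : Function.Injective (mfderiv I 𝓘(ℝ, M₀) (extChartAt I v) v) := by
    have hi := isInvertible_mfderiv_extChartAt (I := I) (mem_extChartAt_source (I := I) v)
    obtain ⟨L, hL⟩ := hi
    rw [← hL]
    exact L.injective
  refine hinj ?_
  have hsep : ∀ ℓ : M₀ →L[ℝ] ℝ, ℓ (mfderiv I 𝓘(ℝ, M₀) (extChartAt I v) v X) =
      ℓ (mfderiv I 𝓘(ℝ, M₀) (extChartAt I v) v Y) := by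
    intro ℓ
    have hG : ContMDiff I 𝓘(ℝ, ℝ) ∞ (fun x => f x • ℓ (extChartAt I v x)) :=
      f.contMDiff_smul ((ℓ.contDiff.contMDiff).comp_contMDiffOn (contMDiffOn_extChartAt (x := v)))
    have h1 := h _ hG
    have h2 : (fun x => f x • ℓ (extChartAt I v x)) =ᶠ[nhds v] ℓ ∘ extChartAt I v := by
      filter_upwards [f.eventuallyEq_one] with x hx
      simp [hx]
    have h3 : HasMFDerivAt I 𝓘(ℝ, ℝ) (fun x => f x • ℓ (extChartAt I v x)) v
        (ContinuousLinearMap.comp ℓ (mfderiv I 𝓘(ℝ, M₀) (extChartAt I v) v)) :=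
      (HasMFDerivAt.comp v (ℓ.hasMFDerivAt)
        (mdifferentiableAt_extChartAt (I := I) (mem_chart_source H₀ v)).hasMFDerivAt).congr_of_eventuallyEq h2
    change mfderiv I 𝓘(ℝ, ℝ) _ v X = mfderiv I 𝓘(ℝ, ℝ) _ v Y at h1
    rw [h3.mfderiv] at h1
    exact h1
  by_contra hne
  obtain ⟨ℓ, hℓ⟩ := SeparatingDual.exists_separating_of_ne (R := ℝ) (V := M₀) hne
  exact hℓ (hsep ℓ)

variable {B : Type uB} [NormedAddCommGroup B] [NormedSpace ℝ B]
  {Q : Type uQ} [TopologicalSpace Q] [ChartedSpace B Q] [T2Space Q]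
  {F : Type uF} [NormedAddCommGroup F] [NormedSpace ℝ F]
  {E : Q → Type uE}
  [∀ q, TopologicalSpace (E q)] [TopologicalSpace (TotalSpace F E)]
  [FiberBundle F E]

variable (F E) in
theorem t2Space_totalSpace : T2Space (TotalSpace F E) := by
  refine ⟨fun x y hxy => ?_⟩
  by_cases hp : x.1 = y.1
  · let e := trivializationAt F E x.1
    have hx : x ∈ e.source := e.mem_source.2 (FiberBundle.mem_baseSet_trivializationAt' _)
    have hy : y ∈ e.source := e.mem_source.2 (by
      rw [← show x.1 = y.1 from hp]; exact FiberBundle.mem_baseSet_trivializationAt' _)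
    have hne : e x ≠ e y := fun h => hxy (e.injOn hx hy h)
    obtain ⟨u, v, hu, hv, hxu, hyv, huv⟩ := t2_separation hne
    refine ⟨e.source ∩ e ⁻¹' u, e.source ∩ e ⁻¹' v, ?_, ?_, ⟨hx, hxu⟩, ⟨hy, hyv⟩, ?_⟩
    · exact e.toOpenPartialHomeomorph.isOpen_inter_preimage hu
    · exact e.toOpenPartialHomeomorph.isOpen_inter_preimage hv
    · exact (huv.preimage e).mono inter_subset_right inter_subset_right
  · obtain ⟨u, v, hu, hv, hxu, hyv, huv⟩ := t2_separation hp
    have hc := FiberBundle.continuous_proj F E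
    exact ⟨_, _, hu.preimage hc, hv.preimage hc, hxu, hyv, huv.preimage _⟩
end
section
universe uB uQ uF uE
variable {B : Type uB} [NormedAddCommGroup B] [NormedSpace ℝ B] [FiniteDimensional ℝ B]
  {Q : Type uQ} [TopologicalSpace Q] [ChartedSpace B Q] [IsManifold 𝓘(ℝ, B) ∞ Q] [T2Space Q]
  {F : Type uF} [NormedAddCommGroup F] [NormedSpace ℝ F] [FiniteDimensional ℝ F]
  {E : Q → Type uE} [∀ q, AddCommGroup (E q)] [∀ q, Module ℝ (E q)]
  [∀ q, TopologicalSpace (E q)] [TopologicalSpace (TotalSpace F E)]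
  [FiberBundle F E] [VectorBundle ℝ F E] [ContMDiffVectorBundle ∞ F E 𝓘(ℝ, B)]

namespace HamiltonianSystem
variable (S : HamiltonianSystem B F E)

/-- For `v ∈ V^*` there is exactly one tangent vector `X` of `V^*` at `v` with
`X(G) = {G ∘ μ, F_h}(α)` for all smooth `G : V^* → ℝ` and all `α ∈ E^*` over `v`. -/
theorem existsUnique_hamiltonianVector (v : S.VDual) :
    ∃! X : TangentSpace (𝓘(ℝ, B).prod 𝓘(ℝ, KerModel F →L[ℝ] ℝ)) v,
      ∀ G : S.VDual → ℝ, ContMDiff (𝓘(ℝ, B).prod 𝓘(ℝ, KerModel F →L[ℝ] ℝ)) 𝓘(ℝ, ℝ) ∞ G →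
        ∀ α : DualBundle F E, S.mu α = v →
          mvfderiv (𝓘(ℝ, B).prod 𝓘(ℝ, KerModel F →L[ℝ] ℝ)) G v X =
            S.poisson (G ∘ S.mu) S.energy α := by
  obtain ⟨X, hX⟩ := S.exists_hamiltonianVector v
  refine ⟨X, hX, fun Y hY => ?_⟩
  have : T2Space S.VDual := t2Space_totalSpace _ _
  refine eq_of_forall_mvfderiv fun G hG => ?_
  rw [hX G hG _ (S.mu_h v), hY G hG _ (S.mu_h v)]

/-- The Hamiltonian vector field `R_h` on `V^*`, characterized by `R_h(G) ∘ μ = {G ∘ μ, F_h}` for all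
smooth functions `G` on `V^*`. -/
def hamiltonianVectorField (v : S.VDual) :
    TangentSpace (𝓘(ℝ, B).prod 𝓘(ℝ, KerModel F →L[ℝ] ℝ)) v :=
  (S.existsUnique_hamiltonianVector v).choose

theorem hamiltonianVectorField_spec {G : S.VDual → ℝ}
    (hG : ContMDiff (𝓘(ℝ, B).prod 𝓘(ℝ, KerModel F →L[ℝ] ℝ)) 𝓘(ℝ, ℝ) ∞ G) (α : DualBundle F E) :
    mvfderiv (𝓘(ℝ, B).prod 𝓘(ℝ, KerModel F →L[ℝ] ℝ)) G (S.mu α)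
        (S.hamiltonianVectorField (S.mu α)) = S.poisson (G ∘ S.mu) S.energy α :=
  (S.existsUnique_hamiltonianVector (S.mu α)).choose_spec.1 G hG α rfl

/-- The skew-symmetric algebroid structure of `V`. -/
def algebroidV : SkewAlgebroid B (KerModel F) S.V := S.toSkewAlgebroid.restrict S.isCocycle

/-- The vector field `R_h^α = Tτ ∘ R_h ∘ α` on `Q`, for a section `α` of `V^*` and `τ : V^* → Q` the
projection. -/
def reducedVectorField (α : Sec B (KerModel F →L[ℝ] ℝ) (DualFiber S.V)) (q : Q) :
    TangentSpace 𝓘(ℝ, B) q :=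
  mfderiv (𝓘(ℝ, B).prod 𝓘(ℝ, KerModel F →L[ℝ] ℝ)) 𝓘(ℝ, B)
    (TotalSpace.proj : S.VDual → Q) ⟨q, α q⟩ (S.hamiltonianVectorField ⟨q, α q⟩)

end HamiltonianSystem
end

section
universe uB uQ uF uE uB' uQ' uF' uE'
variable (B : Type uB) [NormedAddCommGroup B] [NormedSpace ℝ B]
  {Q : Type uQ} [TopologicalSpace Q] [ChartedSpace B Q]
  (F : Type uF) [NormedAddCommGroup F] [NormedSpace ℝ F]
  (E : Q → Type uE) [∀ q, AddCommGroup (E q)] [∀ q, Module ℝ (E q)]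
  [∀ q, TopologicalSpace (E q)] [TopologicalSpace (TotalSpace F E)]
  [FiberBundle F E] [VectorBundle ℝ F E]
  (B' : Type uB') [NormedAddCommGroup B'] [NormedSpace ℝ B']
  {Q' : Type uQ'} [TopologicalSpace Q'] [ChartedSpace B' Q']
  (F' : Type uF') [NormedAddCommGroup F'] [NormedSpace ℝ F']
  (E' : Q' → Type uE') [∀ q, AddCommGroup (E' q)] [∀ q, Module ℝ (E' q)]
  [∀ q, TopologicalSpace (E' q)] [TopologicalSpace (TotalSpace F' E')]
  [FiberBundle F' E'] [VectorBundle ℝ F' E']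

/-- A morphism of smooth vector bundles `E → E'` over the map `ψ` of the base manifolds: a smooth map
of total spaces, linear from each fibre `E_q` to the fibre of `E'` over `ψ(q)`. -/
structure BundleMorphism (ψ : Q → Q') where
  fiber : ∀ q, E q →ₗ[ℝ] E' (ψ q)
  contMDiff_base : ContMDiff 𝓘(ℝ, B) 𝓘(ℝ, B') ∞ ψ
  contMDiff_total : ContMDiff (𝓘(ℝ, B).prod 𝓘(ℝ, F)) (𝓘(ℝ, B').prod 𝓘(ℝ, F')) ∞
    (fun v : TotalSpace F E => (⟨ψ v.1, fiber v.1 v.2⟩ : TotalSpace F' E'))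

variable {B F E B' F' E'} {ψ : Q → Q'}

/-- The map of total spaces. -/
def BundleMorphism.total (Φ : BundleMorphism B F E B' F' E' ψ) (v : TotalSpace F E) :
    TotalSpace F' E' := ⟨ψ v.1, Φ.fiber v.1 v.2⟩

/-- The sections `σ` of `E` and `σ'` of `E'` are related: `Φ ∘ σ = σ' ∘ ψ`. -/
def BundleMorphism.Related (Φ : BundleMorphism B F E B' F' E' ψ) (σ : Sec B F E)
    (σ' : Sec B' F' E') : Prop :=
  ∀ q, Φ.fiber q (σ q) = σ' (ψ q)
end

section
universe uB uQ uF uE uB' uQ' uF' uE'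
variable
  {B : Type uB} [NormedAddCommGroup B] [NormedSpace ℝ B] [FiniteDimensional ℝ B]
  {Q : Type uQ} [TopologicalSpace Q] [ChartedSpace B Q] [IsManifold 𝓘(ℝ, B) ∞ Q] [T2Space Q]
  {F : Type uF} [NormedAddCommGroup F] [NormedSpace ℝ F] [FiniteDimensional ℝ F]
  {E : Q → Type uE} [∀ q, AddCommGroup (E q)] [∀ q, Module ℝ (E q)]
  [∀ q, TopologicalSpace (E q)] [TopologicalSpace (TotalSpace F E)]
  [FiberBundle F E] [VectorBundle ℝ F E] [ContMDiffVectorBundle ∞ F E 𝓘(ℝ, B)]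
  {B' : Type uB'} [NormedAddCommGroup B'] [NormedSpace ℝ B'] [FiniteDimensional ℝ B']
  {Q' : Type uQ'} [TopologicalSpace Q'] [ChartedSpace B' Q'] [IsManifold 𝓘(ℝ, B') ∞ Q']
  [T2Space Q']
  {F' : Type uF'} [NormedAddCommGroup F'] [NormedSpace ℝ F'] [FiniteDimensional ℝ F']
  {E' : Q' → Type uE'} [∀ q, AddCommGroup (E' q)] [∀ q, Module ℝ (E' q)]
  [∀ q, TopologicalSpace (E' q)] [TopologicalSpace (TotalSpace F' E')]
  [FiberBundle F' E'] [VectorBundle ℝ F' E'] [ContMDiffVectorBundle ∞ F' E' 𝓘(ℝ, B')]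

/-- The map `Φ : E^* → E'^*` is almost Poisson: `{F₁ ∘ Φ, F₂ ∘ Φ} = {F₁, F₂} ∘ Φ` for all smooth
functions `F₁`, `F₂` on `E'^*`. -/
def IsAlmostPoisson (A : SkewAlgebroid B F E) (A' : SkewAlgebroid B' F' E')
    (Φ : DualBundle F E → DualBundle F' E') : Prop :=
  ∀ F₁ F₂ : DualBundle F' E' → ℝ,
    ContMDiff (𝓘(ℝ, B').prod 𝓘(ℝ, F' →L[ℝ] ℝ)) 𝓘(ℝ, ℝ) ∞ F₁ →
    ContMDiff (𝓘(ℝ, B').prod 𝓘(ℝ, F' →L[ℝ] ℝ)) 𝓘(ℝ, ℝ) ∞ F₂ →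
      A.poisson (F₁ ∘ Φ) (F₂ ∘ Φ) = A'.poisson F₁ F₂ ∘ Φ

/-- The vector bundle morphism `Ψ : E^* → E'^*` over `ψ` is a Hamiltonian morphism: it is almost
Poisson, it relates the two cocycles, and `F_{h'} ∘ Ψ = F_h`. -/
structure IsHamiltonianMorphism (S : HamiltonianSystem B F E) (S' : HamiltonianSystem B' F' E')
    {ψ : Q → Q'}
    (Ψ : BundleMorphism B (F →L[ℝ] ℝ) (DualFiber E) B' (F' →L[ℝ] ℝ) (DualFiber E') ψ) : Prop where
  isAlmostPoisson : IsAlmostPoisson S.toSkewAlgebroid S'.toSkewAlgebroid Ψ.total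
  related_phi : Ψ.Related S.phi.toSec S'.phi.toSec
  energy_comp : S'.energy ∘ Ψ.total = S.energy
end

end HamiltonJacobi

end

open HamiltonJacobi

/-! A form on E_q that vanishes on V_q = ker φ(q) is a multiple of φ(q), so the fibres of μ are the
affine lines α + ℝφ(q). A bundle morphism Ψ with Ψ ∘ φ = φ' ∘ ψ carries such lines to lines of the
same kind in E'^*, hence descends to a map Φ : V^* → V'^* with Φ ∘ μ = μ' ∘ Ψ. Since h is a section
of μ, necessarily Φ = μ' ∘ Ψ ∘ h. This formula makes Φ visibly smooth. It is also fibrewise linear,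
even when h is not: the defect of linearity of h is a multiple of φ, which Ψ sends to a multiple of
φ', and μ' kills that (`muFiber_fiber_congr`, `inducedMorphism`).

The analytic content is that μ is itself almost Poisson (`isAlmostPoisson_mu`). It is dual to the
inclusion V → E, which respects brackets and anchors because those of V are restrictions of those of
E. The proof evaluates both brackets by the formula (d s)(x, y) + ρ(y)(G ∘ s) - ρ(x)(H ∘ s), where s
is a section of E^* through the given point and x, y are fibre derivatives. Restricting s to V gives
a section through the image point, and the fibre derivatives of G ∘ μ and H ∘ μ are those of G and
H, included in E. The two formulas then agree term by term.

The rest is a chase around the square Φ ∘ μ = μ' ∘ Ψ, using that μ is surjective. For brackets, {G ∘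
Φ, H ∘ Φ} ∘ μ = {G ∘ Φ ∘ μ, H ∘ Φ ∘ μ} = {G ∘ μ' ∘ Ψ, H ∘ μ' ∘ Ψ} = {G ∘ μ', H ∘ μ'} ∘ Ψ = {G, H} ∘
μ' ∘ Ψ = {G, H} ∘ Φ ∘ μ. For the Hamiltonian vector fields, F_h = F_{h'} ∘ Ψ gives R_h(G ∘ Φ) ∘ μ =
{G ∘ μ' ∘ Ψ, F_{h'} ∘ Ψ} = {G ∘ μ', F_{h'}} ∘ Ψ = R_{h'}(G) ∘ Φ ∘ μ, and smooth functions separate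
tangent vectors. Projecting this relation to the bases along τ' ∘ Φ = ψ ∘ τ gives the statement on
R_h^α. -/

namespace HamiltonJacobi

/-! ### The fibres of μ -/

section
universe uB uQ uF uE
variable {B : Type uB} [NormedAddCommGroup B] [NormedSpace ℝ B]
  {Q : Type uQ} [TopologicalSpace Q] [ChartedSpace B Q]
  {F : Type uF} [NormedAddCommGroup F] [NormedSpace ℝ F]
  {E : Q → Type uE} [∀ q, AddCommGroup (E q)] [∀ q, Module ℝ (E q)]
  [∀ q, TopologicalSpace (E q)] [TopologicalSpace (TotalSpace F E)]
  [FiberBundle F E] [VectorBundle ℝ F E]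

/-- Forms with the same restriction to `V_q` differ by a multiple of `φ(q)`. -/
theorem NonvanishingCovector.exists_eq_add_smul (φ : NonvanishingCovector B F E) {q : Q}
    {β β' : DualFiber E q} (h : muFiber φ β = muFiber φ β') :
    ∃ c : ℝ, β = β' + c • φ.toSec q := by
  obtain ⟨e, he⟩ := φ.exists_eq_one q
  have h1 : (β - β').comp (KerFiber.incl φ q) = 0 := by
    rw [ContinuousLinearMap.sub_comp]
    exact sub_eq_zero.2 h
  -- A form that kills V_q is determined by its value at e, where φ(q)(e) = 1; the coefficient is
  -- therefore (β - β')(e).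
  have h2 := φ.smul_eq h1 e
  rw [he, one_smul] at h2
  exact ⟨(β - β') e, by rw [← h2]; abel⟩

theorem muFiber_add (φ : NonvanishingCovector B F E) {q : Q} (β β' : DualFiber E q) :
    muFiber φ (β + β') = muFiber φ β + muFiber φ β' := rfl

theorem muFiber_smul (φ : NonvanishingCovector B F E) {q : Q} (c : ℝ) (β : DualFiber E q) :
    muFiber φ (c • β) = c • muFiber φ β := rfl

theorem muFiber_phi (φ : NonvanishingCovector B F E) (q : Q) : muFiber φ (φ.toSec q) = 0 := by
  ext x
  simp [muFiber]

end

/-! ### The restriction map μ is almost Poisson -/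

section
universe uB uQ uF uE
variable {B : Type uB} [NormedAddCommGroup B] [NormedSpace ℝ B] [FiniteDimensional ℝ B]
  {Q : Type uQ} [TopologicalSpace Q] [ChartedSpace B Q] [IsManifold 𝓘(ℝ, B) ∞ Q] [T2Space Q]
  {F : Type uF} [NormedAddCommGroup F] [NormedSpace ℝ F] [FiniteDimensional ℝ F]
  {E : Q → Type uE} [∀ q, AddCommGroup (E q)] [∀ q, Module ℝ (E q)]
  [∀ q, TopologicalSpace (E q)] [TopologicalSpace (TotalSpace F E)]
  [FiberBundle F E] [VectorBundle ℝ F E] [ContMDiffVectorBundle ∞ F E 𝓘(ℝ, B)]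

/-- Chain rule along a fibre. As μ is linear on fibres, the derivative of G ∘ μ at α in the
direction β is that of G at μ(α) in the direction μ(β), and pairing a vector of V_q with μ(β) is
pairing its inclusion in E_q with β. Forms on E_q separate vectors. Smoothness of G guarantees that
the fibre derivatives are genuine and not the default value 0. -/
theorem fiberDeriv_comp_mu (φ : NonvanishingCovector B F E)
    {G : DualBundle (KerModel F) (KerFiber φ) → ℝ}
    (hG : ContMDiff (𝓘(ℝ, B).prod 𝓘(ℝ, KerModel F →L[ℝ] ℝ)) 𝓘(ℝ, ℝ) ∞ G) (α : DualBundle F E) :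
    fiberDeriv (G ∘ mu φ) α = KerFiber.incl φ α.1 (fiberDeriv G (mu φ α)) := by
  refine eq_of_forall_dual (fun β => ?_) F
  rw [apply_fiberDeriv ((hG.comp (contMDiff_mu φ)).mdifferentiable (by simp) _) β]
  exact (apply_fiberDeriv (hG.mdifferentiable (by simp) (mu φ α)) (muFiber φ β)).symm

/-- The restriction to `V` of a section of `E^*`. -/
noncomputable def muSec (φ : NonvanishingCovector B F E) (s : Sec B (F →L[ℝ] ℝ) (DualFiber E)) :
    Sec B (KerModel F →L[ℝ] ℝ) (DualFiber (KerFiber φ)) :=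
  ⟨fun q => muFiber φ (s q), (contMDiff_mu φ).comp s.contMDiff⟩

/-- The inclusion V → E is a morphism of algebroids, so restriction of forms commutes with the
almost differential. Each of the three terms agrees by definition: the pairing, the anchor and the
bracket of V all pass through the inclusion. -/
theorem SkewAlgebroid.dOne_restrict (A : SkewAlgebroid B F E) {φ : NonvanishingCovector B F E}
    (hφ : A.IsCocycle φ.toSec) (s : Sec B (F →L[ℝ] ℝ) (DualFiber E))
    (σ γ : Sec B (KerModel F) (KerFiber φ)) (q : Q) :
    (A.restrict hφ).dOne (muSec φ s) σ γ q =
      A.dOne s (KerFiber.inclSec φ σ) (KerFiber.inclSec φ γ) q := rfl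

/-- The map `μ : E^* → V^*` is almost Poisson. -/
theorem isAlmostPoisson_mu (A : SkewAlgebroid B F E) {φ : NonvanishingCovector B F E}
    (hφ : A.IsCocycle φ.toSec) : IsAlmostPoisson A (A.restrict hφ) (mu φ) := by
  intro G H hG hH
  funext α
  obtain ⟨q, a⟩ := α
  -- The bracket at a point may be computed along any section through it. One section s of E^*
  -- serves both sides, since its restriction to V passes through the image point.
  obtain ⟨s, rfl⟩ : ∃ s : Sec B (F →L[ℝ] ℝ) (DualFiber E), s q = a :=
    ⟨through B (F →L[ℝ] ℝ) q a, through_self q a⟩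
  have hV : mu φ ⟨q, s q⟩ = ⟨q, muSec φ s q⟩ := rfl
  rw [A.poisson_eq s q (hG.comp (contMDiff_mu φ)) (hH.comp (contMDiff_mu φ)),
    Function.comp_apply, hV, (A.restrict hφ).poisson_eq (muSec φ s) q hG hH]
  simp only [SkewAlgebroid.poissonAlong, fiberDeriv_comp_mu φ hG, fiberDeriv_comp_mu φ hH,
    SkewAlgebroid.dOne_restrict]
  -- The two sides extend the same vectors of V_q to different sections of E: on the left by
  -- extending in E, on the right by extending in V and then including. They agree at q, and the
  -- almost differential of s is tensorial, so only these values count.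
  rw [A.dOne_congr s (σ' := KerFiber.inclSec φ (through B (KerModel F) q
      (fiberDeriv G ⟨q, muSec φ s q⟩))) (γ' := KerFiber.inclSec φ (through B (KerModel F) q
      (fiberDeriv H ⟨q, muSec φ s q⟩)))
    (by rw [through_self, KerFiber.inclSec_apply, through_self]; rfl)
    (by rw [through_self, KerFiber.inclSec_apply, through_self]; rfl)]
  rfl

end

/-! ### The morphism induced on V^* -/

section
universe uB uQ uF uE uB' uQ' uF' uE'
variable
  {B : Type uB} [NormedAddCommGroup B] [NormedSpace ℝ B] [FiniteDimensional ℝ B]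
  {Q : Type uQ} [TopologicalSpace Q] [ChartedSpace B Q] [IsManifold 𝓘(ℝ, B) ∞ Q] [T2Space Q]
  {F : Type uF} [NormedAddCommGroup F] [NormedSpace ℝ F] [FiniteDimensional ℝ F]
  {E : Q → Type uE} [∀ q, AddCommGroup (E q)] [∀ q, Module ℝ (E q)]
  [∀ q, TopologicalSpace (E q)] [TopologicalSpace (TotalSpace F E)]
  [FiberBundle F E] [VectorBundle ℝ F E] [ContMDiffVectorBundle ∞ F E 𝓘(ℝ, B)]
  {B' : Type uB'} [NormedAddCommGroup B'] [NormedSpace ℝ B'] [FiniteDimensional ℝ B']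
  {Q' : Type uQ'} [TopologicalSpace Q'] [ChartedSpace B' Q'] [IsManifold 𝓘(ℝ, B') ∞ Q']
  [T2Space Q']
  {F' : Type uF'} [NormedAddCommGroup F'] [NormedSpace ℝ F'] [FiniteDimensional ℝ F']
  {E' : Q' → Type uE'} [∀ q, AddCommGroup (E' q)] [∀ q, Module ℝ (E' q)]
  [∀ q, TopologicalSpace (E' q)] [TopologicalSpace (TotalSpace F' E')]
  [FiberBundle F' E'] [VectorBundle ℝ F' E'] [ContMDiffVectorBundle ∞ F' E' 𝓘(ℝ, B')]
  {S : HamiltonianSystem B F E} {S' : HamiltonianSystem B' F' E'} {ψ : Q → Q'}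
  {Ψ : BundleMorphism B (F →L[ℝ] ℝ) (DualFiber E) B' (F' →L[ℝ] ℝ) (DualFiber E') ψ}

/-- This is the descent of Ψ to the quotients by the lines ℝφ: β and β' differ by c φ(q), their
images by c φ'(ψ(q)), and the latter restricts to zero on V'. It makes μ' ∘ Ψ independent of the
lift chosen in E^*, and so yields both the linearity of the induced map and its compatibility with
μ. -/
theorem muFiber_fiber_congr (hΨ : Ψ.Related S.phi.toSec S'.phi.toSec) {q : Q}
    {β β' : DualFiber E q} (h : muFiber S.phi β = muFiber S.phi β') :
    muFiber S'.phi (Ψ.fiber q β) = muFiber S'.phi (Ψ.fiber q β') := by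
  obtain ⟨c, rfl⟩ := S.phi.exists_eq_add_smul h
  rw [map_add, map_smul, hΨ, muFiber_add, muFiber_smul, muFiber_phi, smul_zero, add_zero]

/-- The morphism `V^* → V'^*` induced by a morphism `E^* → E'^*` which relates the cocycles. -/
noncomputable def inducedMorphism (S : HamiltonianSystem B F E) (S' : HamiltonianSystem B' F' E')
    (Ψ : BundleMorphism B (F →L[ℝ] ℝ) (DualFiber E) B' (F' →L[ℝ] ℝ) (DualFiber E') ψ)
    (hΨ : Ψ.Related S.phi.toSec S'.phi.toSec) :
    BundleMorphism B (KerModel F →L[ℝ] ℝ) (DualFiber S.V)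
      B' (KerModel F' →L[ℝ] ℝ) (DualFiber S'.V) ψ where
  fiber q :=
    -- The section h serves as a choice of lift from V^* to E^*; the resulting map does not depend
    -- on it.
    { toFun := fun v => muFiber S'.phi (Ψ.fiber q (S.h q v))
      map_add' := fun v w => by
        rw [← muFiber_add, ← map_add]
        -- h need not be additive, but h(v + w) and h(v) + h(w) both restrict to v + w, which is
        -- enough. Homogeneity is handled in the same way.
        refine muFiber_fiber_congr hΨ ?_
        rw [muFiber_add, S.mu_h_fiber, S.mu_h_fiber, S.mu_h_fiber]
      map_smul' := fun c v => by
        rw [RingHom.id_apply, ← muFiber_smul, ← map_smul]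
        refine muFiber_fiber_congr hΨ ?_
        rw [muFiber_smul, S.mu_h_fiber, S.mu_h_fiber] }
  contMDiff_base := Ψ.contMDiff_base
  -- Smoothness comes from the global smooth lift h; no local sections of μ have to be constructed.
  contMDiff_total := (contMDiff_mu S'.phi).comp (Ψ.contMDiff_total.comp S.contMDiff_h)

/-- Both α and h(μ(α)) lift μ(α), so μ' ∘ Ψ takes the same value on them. -/
theorem inducedMorphism_comp_mu (hΨ : Ψ.Related S.phi.toSec S'.phi.toSec) :
    (inducedMorphism S S' Ψ hΨ).total ∘ S.mu = S'.mu ∘ Ψ.total := by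
  funext α
  have h : muFiber S'.phi (Ψ.fiber α.1 (S.h α.1 (muFiber S.phi α.2))) =
      muFiber S'.phi (Ψ.fiber α.1 α.2) :=
    muFiber_fiber_congr hΨ (S.mu_h_fiber _ _)
  exact congrArg (fun b => (⟨ψ α.1, b⟩ : S'.VDual)) h

/-! ### Brackets and vector fields under the induced morphism -/

/-- The maps μ, Ψ and μ' are almost Poisson and Φ ∘ μ = μ' ∘ Ψ. As μ is surjective, the identity for
Φ can be tested after composition with μ, where it follows from the other three. -/
theorem isAlmostPoisson_inducedMorphism (hΨ : IsHamiltonianMorphism S S' Ψ) :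
    IsAlmostPoisson S.algebroidV S'.algebroidV (inducedMorphism S S' Ψ hΨ.related_phi).total := by
  intro G H hG hH
  set Φ := inducedMorphism S S' Ψ hΨ.related_phi with hΦ
  have hc : Φ.total ∘ S.mu = S'.mu ∘ Ψ.total := inducedMorphism_comp_mu hΨ.related_phi
  funext v
  -- Surjectivity of μ: h(v) is a preimage of v.
  obtain ⟨α, rfl⟩ : ∃ α, S.mu α = v := ⟨S.hMap v, S.mu_h v⟩
  have h1 := congrFun (isAlmostPoisson_mu S.toSkewAlgebroid S.isCocycle _ _
    (hG.comp Φ.contMDiff_total) (hH.comp Φ.contMDiff_total)) α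
  have h2 := congrFun (hΨ.isAlmostPoisson _ _ (hG.comp (contMDiff_mu S'.phi))
    (hH.comp (contMDiff_mu S'.phi))) α
  have h3 := congrFun (isAlmostPoisson_mu S'.toSkewAlgebroid S'.isCocycle G H hG hH) (Ψ.total α)
  have h4 : ∀ K : S'.VDual → ℝ, (K ∘ Φ.total) ∘ S.mu = (K ∘ S'.mu) ∘ Ψ.total := fun K => by
    rw [Function.comp_assoc, hc, Function.comp_assoc]
  have h5 : Φ.total (S.mu α) = S'.mu (Ψ.total α) := congrFun hc α
  rw [Function.comp_apply, h5]
  refine h1.symm.trans (Eq.trans ?_ (h2.trans h3))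
  exact congrArg₂ (fun K L => S.poisson K L α) (h4 G) (h4 H)

/-- Both vectors are tested on smooth functions G of V'^*. After lifting v to E^*, each derivative
becomes a bracket with the energy function, and Ψ preserves brackets and energies. -/
theorem hamiltonianVectorField_inducedMorphism (hΨ : IsHamiltonianMorphism S S' Ψ) (v : S.VDual) :
    S'.hamiltonianVectorField ((inducedMorphism S S' Ψ hΨ.related_phi).total v) =
      mfderiv (𝓘(ℝ, B).prod 𝓘(ℝ, KerModel F →L[ℝ] ℝ)) (𝓘(ℝ, B').prod 𝓘(ℝ, KerModel F' →L[ℝ] ℝ))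
        (inducedMorphism S S' Ψ hΨ.related_phi).total v (S.hamiltonianVectorField v) := by
  set Φ := inducedMorphism S S' Ψ hΨ.related_phi with hΦ
  have hc : Φ.total ∘ S.mu = S'.mu ∘ Ψ.total := inducedMorphism_comp_mu hΨ.related_phi
  have hs : ContMDiff (𝓘(ℝ, B).prod 𝓘(ℝ, KerModel F →L[ℝ] ℝ))
      (𝓘(ℝ, B').prod 𝓘(ℝ, KerModel F' →L[ℝ] ℝ)) ∞ Φ.total := Φ.contMDiff_total
  -- Separation of tangent vectors by global functions relies on bump functions, hence on V'^* being
  -- Hausdorff.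
  have : T2Space S'.VDual := t2Space_totalSpace _ _
  refine eq_of_forall_mvfderiv fun G hG => ?_
  -- By the chain rule, G differentiated along TΦ(R_h) is R_h(G ∘ Φ).
  refine Eq.trans ?_ (mvfderiv_comp_apply (g := G) (f := Φ.total) v
    (hG.mdifferentiable (by simp) _) (hs.mdifferentiable (by simp) v) _)
  obtain ⟨α, rfl⟩ : ∃ α, S.mu α = v := ⟨S.hMap v, S.mu_h v⟩
  rw [S.hamiltonianVectorField_spec (hG.comp hs) α]
  have h5 : Φ.total (S.mu α) = S'.mu (Ψ.total α) := congrFun hc α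
  -- The base point must be written as μ'(Ψ(α)) for the characterization of R_{h'} to apply.
  -- Replacing Φ ∘ μ by μ' ∘ Ψ and F_h by F_{h'} ∘ Ψ then leaves exactly the almost Poisson property
  -- of Ψ for G ∘ μ' and F_{h'}.
  rw [h5, S'.hamiltonianVectorField_spec hG (Ψ.total α), Function.comp_assoc, hc,
    ← Function.comp_assoc, ← hΨ.energy_comp]
  exact (congrFun (hΨ.isAlmostPoisson _ _ (hG.comp (contMDiff_mu S'.phi)) S'.contMDiff_energy)
    α).symm

/-- If a bundle morphism `V^* → V'^*` over `ψ` relates the Hamiltonian vector fields, then `ψ`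
relates the reduced vector fields of related sections. -/
theorem reducedVectorField_related
    (Φ : BundleMorphism B (KerModel F →L[ℝ] ℝ) (DualFiber S.V)
      B' (KerModel F' →L[ℝ] ℝ) (DualFiber S'.V) ψ)
    (hΦ : ∀ v : S.VDual, S'.hamiltonianVectorField (Φ.total v) =
      mfderiv (𝓘(ℝ, B).prod 𝓘(ℝ, KerModel F →L[ℝ] ℝ)) (𝓘(ℝ, B').prod 𝓘(ℝ, KerModel F' →L[ℝ] ℝ))
        Φ.total v (S.hamiltonianVectorField v))
    {α : Sec B (KerModel F →L[ℝ] ℝ) (DualFiber S.V)}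
    {α' : Sec B' (KerModel F' →L[ℝ] ℝ) (DualFiber S'.V)} (hα : Φ.Related α α') (q : Q) :
    S'.reducedVectorField α' (ψ q) =
      mfderiv 𝓘(ℝ, B) 𝓘(ℝ, B') ψ q (S.reducedVectorField α q) := by
  have hs : ContMDiff (𝓘(ℝ, B).prod 𝓘(ℝ, KerModel F →L[ℝ] ℝ))
      (𝓘(ℝ, B').prod 𝓘(ℝ, KerModel F' →L[ℝ] ℝ)) ∞ Φ.total := Φ.contMDiff_total
  have hp : ContMDiff (𝓘(ℝ, B).prod 𝓘(ℝ, KerModel F →L[ℝ] ℝ)) 𝓘(ℝ, B) ∞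
    (TotalSpace.proj : S.VDual → Q) := contMDiff_proj _
  have hp' : ContMDiff (𝓘(ℝ, B').prod 𝓘(ℝ, KerModel F' →L[ℝ] ℝ)) 𝓘(ℝ, B') ∞
    (TotalSpace.proj : S'.VDual → Q') := contMDiff_proj _
  set v : S.VDual := ⟨q, α q⟩ with hv
  have h0 : S'.reducedVectorField α' (ψ q) =
      mfderiv (𝓘(ℝ, B').prod 𝓘(ℝ, KerModel F' →L[ℝ] ℝ)) 𝓘(ℝ, B')
        (TotalSpace.proj : S'.VDual → Q') (Φ.total v)
        (S'.hamiltonianVectorField (Φ.total v)) := by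
    -- Relatedness of the sections enters here: the point α'(ψ(q)) of V'^* is Φ(α(q)).
    rw [HamiltonianSystem.reducedVectorField, ← hα q]
    rfl
  rw [h0, hΦ v]
  have h1 := mfderiv_comp_apply v (hp'.mdifferentiable (by simp) (Φ.total v))
    (hs.mdifferentiable (by simp) v) (S.hamiltonianVectorField v)
  have h2 := mfderiv_comp_apply v (Φ.contMDiff_base.mdifferentiable (by simp) v.1)
    (hp.mdifferentiable (by simp) v) (S.hamiltonianVectorField v)
  -- The two chain rules differentiate τ' ∘ Φ and ψ ∘ τ, which are the same map by definition of Φ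
  -- on total spaces.
  exact h1.symm.trans h2

end

end HamiltonJacobi

/-! ### The proposition -/

theorem proposition3p5
  {B : Type*} [NormedAddCommGroup B] [NormedSpace ℝ B] [FiniteDimensional ℝ B]
  {Q : Type*} [TopologicalSpace Q] [ChartedSpace B Q] [IsManifold 𝓘(ℝ, B) ∞ Q] [T2Space Q]
  {F : Type*} [NormedAddCommGroup F] [NormedSpace ℝ F] [FiniteDimensional ℝ F]
  {E : Q → Type*} [∀ q, AddCommGroup (E q)] [∀ q, Module ℝ (E q)]
  [∀ q, TopologicalSpace (E q)] [TopologicalSpace (TotalSpace F E)]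
  [FiberBundle F E] [VectorBundle ℝ F E] [ContMDiffVectorBundle ∞ F E 𝓘(ℝ, B)]
  {B' : Type*} [NormedAddCommGroup B'] [NormedSpace ℝ B'] [FiniteDimensional ℝ B']
  {Q' : Type*} [TopologicalSpace Q'] [ChartedSpace B' Q'] [IsManifold 𝓘(ℝ, B') ∞ Q']
  [T2Space Q']
  {F' : Type*} [NormedAddCommGroup F'] [NormedSpace ℝ F'] [FiniteDimensional ℝ F']
  {E' : Q' → Type*} [∀ q, AddCommGroup (E' q)] [∀ q, Module ℝ (E' q)]
  [∀ q, TopologicalSpace (E' q)] [TopologicalSpace (TotalSpace F' E')]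
  [FiberBundle F' E'] [VectorBundle ℝ F' E'] [ContMDiffVectorBundle ∞ F' E' 𝓘(ℝ, B')]
  (S : HamiltonianSystem B F E) (S' : HamiltonianSystem B' F' E') (ψ : Q → Q')
  (Ψ : BundleMorphism B (F →L[ℝ] ℝ) (DualFiber E) B' (F' →L[ℝ] ℝ) (DualFiber E') ψ)
  (hΨ : IsHamiltonianMorphism S S' Ψ) :
  ∃ Φ : BundleMorphism B (KerModel F →L[ℝ] ℝ) (DualFiber S.V)
      B' (KerModel F' →L[ℝ] ℝ) (DualFiber S'.V) ψ,
    IsAlmostPoisson S.algebroidV S'.algebroidV Φ.total ∧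
    Φ.total ∘ S.mu = S'.mu ∘ Ψ.total ∧
    (∀ v : S.VDual, (Φ.total v).proj = ψ v.proj) ∧
    (∀ v : S.VDual, S'.hamiltonianVectorField (Φ.total v) =
      mfderiv (𝓘(ℝ, B).prod 𝓘(ℝ, KerModel F →L[ℝ] ℝ)) (𝓘(ℝ, B').prod 𝓘(ℝ, KerModel F' →L[ℝ] ℝ))
        Φ.total v (S.hamiltonianVectorField v)) ∧
    ∀ (α : Sec B (KerModel F →L[ℝ] ℝ) (DualFiber S.V))
      (α' : Sec B' (KerModel F' →L[ℝ] ℝ) (DualFiber S'.V)), Φ.Related α α' →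
      ∀ q, S'.reducedVectorField α' (ψ q) =
        mfderiv 𝓘(ℝ, B) 𝓘(ℝ, B') ψ q (S.reducedVectorField α q) := by
  -- That the induced map covers ψ holds by construction, as the base point of `total` is ψ of the
  -- original one.
  exact ⟨inducedMorphism S S' Ψ hΨ.related_phi, isAlmostPoisson_inducedMorphism hΨ,
    inducedMorphism_comp_mu hΨ.related_phi, fun _ => rfl, hamiltonianVectorField_inducedMorphism hΨ,
    fun _ _ hα q => reducedVectorField_related _ (hamiltonianVectorField_inducedMorphism hΨ) hα q⟩
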